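/- **Setting.** Let $k\in\{1,2,3,4\}$ and let $Y\sim\mathcal N_n(f^0,I)$ with unknown mean $f^0\in\mathbb R^n$. Write $\|v\|_n^2=\frac1n\sum_{i=1}^n v_i^2$ for $v\in\mathbb R^n$. Let $\mathcal D=\{k+1,\dots,n\}$ and let $\Delta(k)\in\mathbb R^{(n-k)\times n}$ be the $k$-th order difference operator, $(\Delta(k)f)_j=\sum_{l=0}^k(-1)^l\binom kl f_{j-l}$ for $j\in\mathcal D$. The trend filtering estimator with tuning parameter $\lambda$ is $$\hat f=\arg\min_{f\in\mathbb R^n}\Bigl\{\|Y-f\|_n^2+2\lambda\|\Delta(k)f\|_1\Bigr\}.$$ Let $S=\{t_1<\dots<t_s\}\subseteq\mathcal D$ ($s\ge 0$) be arbitrary, put $t_0=k$, $t_{s+1}=n+1$, $n_i=t_i-t_{i-1}$ for $1\le i\le s+1$, $n_{\max}=\max_{1\le i\le s+1}n_i$, and $(\Delta(k)f)_{-S}=\{(\Delta(k)f)_j\}_{j\in\mathcal D\setminus S}$. For $u>0$ let $$\lambda_0(u)=\sqrt{\frac{2\log(2(n-k-s))+2u}{n}}.$$ **Theorem.** Let $k\in\{1,2,3,4\}$.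 There exist constants $c_k,C_k>0$ depending only on $k$ such that the following holds for all $n$, $f^0$ and $S$. Let $u>0$ and let $\lambda$ satisfy $$\lambda\ \ge\ c_k\,n^{k-1}\Bigl(\frac{n_{\max}}{2n}\Bigr)^{\frac{2k-1}{2}}\lambda_0(u).$$ Let $f\in\mathbb R^n$ be arbitrary and let $q_{t_1},\dots,q_{t_s}\in\{-1,+1\}$ be such that $q_{t_i}=\operatorname{sign}\bigl((\Delta(k)f)_{t_i}\bigr)$ whenever $(\Delta(k)f)_{t_i}\ne0$ (where $(\Delta(k)f)_{t_i}=0$, either sign may be chosen). Let $$S^\pm=\{i\in\{2,\dots,s\}:\ q_{t_i}q_{t_{i-1}}=-1\}\cup\{1,s+1\},$$ and assume that $n_i\ge k(k+2)$ for all $i\in S^\pm$. Then for every $v>0$, with probability at least $1-e^{-u}-e^{-v}$, $$\|\hat f-f^0\|_n^2\ \le\ \|f-f^0\|_n^2+4\lambda\|(\Delta(k)f)_{-S}\|_1+\Bigl(\sqrt{\tfrac{k(s+1)}{n}}+\sqrt{\tfrac{2v}{n}}+\lambda\Gamma_S\Bigr)^2,$$ where $\Gamma_S\ge0$ is given by $$\Gamma_S^2=n\,C_k\Bigl(\sum_{i\in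 S^\pm}\frac{1+\log n_i}{n_i^{2k-1}}+\sum_{i\in\{1,\dots,s+1\}\setminus S^\pm}\frac{1+\log n_i}{n_{\max}^{2k-1}}\Bigr).$$ -/

import Mathlib

open MeasureTheory ProbabilityTheory

noncomputable section

namespace TrendFilter

/-- Signals in `ℝⁿ`, with coordinates indexed by `1, …, n`. -/
abbrev Vec (n : ℕ) : Type := Finset.Icc 1 n → ℝ

/-- The `k`-th order difference operator `Δ(k) ∈ ℝ^{(n-k) × n}`, with rows indexed by
`k+1, …, n`: its entry at `(i, i - l)` is `(-1)^l * (k choose l)` for `0 ≤ l ≤ k`, and all other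
entries vanish. -/
def diffMatrix (k n : ℕ) : Matrix (Finset.Icc (k + 1) n) (Finset.Icc 1 n) ℝ :=
  fun i j =>
    if (j : ℕ) ≤ i ∧ (i : ℕ) - j ≤ k then
      (-1 : ℝ) ^ ((i : ℕ) - j) * (k.choose ((i : ℕ) - j) : ℝ)
    else 0

/-- The vector `Δ(k) f`, indexed by `k+1, …, n`. -/
def diff (k : ℕ) {n : ℕ} (f : Vec n) : Finset.Icc (k + 1) n → ℝ :=
  (diffMatrix k n).mulVec f

/-- The squared normalized norm `‖v‖ₙ² = (∑ᵢ vᵢ²) / n`. -/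
def normSq {n : ℕ} (v : Vec n) : ℝ := (∑ i, v i ^ 2) / n

/-- The penalized least squares criterion `‖y - f‖ₙ² + 2 lam ‖Δ(k) f‖₁`. -/
def objective (k : ℕ) {n : ℕ} (lam : ℝ) (y f : Vec n) : ℝ :=
  normSq (y - f) + 2 * lam * ∑ j, |diff k f j|

/-- `g` is the `k`-th order trend filtering estimator with tuning parameter `lam` for the data
`y`, i.e. it minimizes the penalized least squares criterion over all of `ℝⁿ`. -/
def IsEstimator (k : ℕ) {n : ℕ} (lam : ℝ) (y g : Vec n) : Prop :=
  ∀ f : Vec n, objective k lam y g ≤ objective k lam y f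

/-- `k = t₀ < t₁ < ⋯ < t_s < t_{s+1} = n + 1`. Only the values `t 0, …, t (s+1)` matter. These
sequences correspond exactly to the subsets `{t₁ < ⋯ < t_s}` of `{k+1, …, n}`. -/
structure IsKnots (k n s : ℕ) (t : ℕ → ℕ) : Prop where
  left : t 0 = k
  right : t (s + 1) = n + 1
  strictMono : ∀ i ≤ s, t i < t (i + 1)

/-- The active set `S = {t₁, …, t_s}`. -/
def activeSet (s : ℕ) (t : ℕ → ℕ) : Finset ℕ := (Finset.Icc 1 s).image t

/-- The segment lengths `nᵢ = tᵢ - tᵢ₋₁`, for `1 ≤ i ≤ s + 1`. -/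
def segLen (t : ℕ → ℕ) (i : ℕ) : ℕ := t i - t (i - 1)

/-- The maximal segment length `n_max`. -/
def maxSegLen (s : ℕ) (t : ℕ → ℕ) : ℕ := (Finset.Icc 1 (s + 1)).sup (segLen t)

/-- `‖(Δ(k) f)_{-S}‖₁`: the sum of `|(Δ(k) f)_j|` over `j ∈ {k+1, …, n} \ S`. -/
def inactiveL1 (k : ℕ) {n : ℕ} (s : ℕ) (t : ℕ → ℕ) (f : Vec n) : ℝ :=
  ∑ j : Finset.Icc (k + 1) n, if (j : ℕ) ∈ activeSet s t then 0 else |diff k f j|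

/-- `q i ∈ {-1, +1}` is the sign of `(Δ(k) f)_{t i}` for `1 ≤ i ≤ s`; where `(Δ(k) f)_{t i}`
vanishes, either sign may be chosen. -/
def IsSignVector (k : ℕ) {n : ℕ} (s : ℕ) (t : ℕ → ℕ) (f : Vec n) (q : ℕ → ℝ) : Prop :=
  ∀ i ∈ Finset.Icc 1 s, (q i = 1 ∨ q i = -1) ∧
    ∀ j : Finset.Icc (k + 1) n, (j : ℕ) = t i → diff k f j ≠ 0 → q i = Real.sign (diff k f j)

/-- `S^±`: the indices `i ∈ {2, …, s}` with a sign change between `tᵢ₋₁` and `tᵢ`, together with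
the two boundary indices `1` and `s + 1`. -/
def signChanges (s : ℕ) (q : ℕ → ℝ) : Finset ℕ :=
  {i ∈ Finset.Icc 2 s | q i * q (i - 1) = -1} ∪ {1, s + 1}

/-- `λ₀(u) = √((2 log (2 (n - k - s)) + 2 u) / n)`. -/
def lambda₀ (n k s : ℕ) (u : ℝ) : ℝ :=
  √((2 * Real.log (2 * ((n : ℝ) - k - s)) + 2 * u) / n)

/-- `Γ_S²`, the bound for the effective sparsity, with constant `C`. -/
def gammaSq (n k s : ℕ) (t : ℕ → ℕ) (q : ℕ → ℝ) (C : ℝ) : ℝ :=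
  n * C * (∑ i ∈ signChanges s q,
        (1 + Real.log (segLen t i)) / (segLen t i : ℝ) ^ (2 * k - 1)
    + ∑ i ∈ Finset.Icc 1 (s + 1) \ signChanges s q,
        (1 + Real.log (segLen t i)) / (maxSegLen s t : ℝ) ^ (2 * k - 1))

end TrendFilter

end

/-! ### Discrete calculus: square sums of differences, iterated sums, an analogue of d^(k - 1/2). -/

namespace TrendFilter

open Finset fwdDiff

/-! Write h for the estimator minus f, and ε = Y - f⁰. Optimality and convexity of the penalty
reduce the claim to bounding ⟨ε, h⟩ / n by a multiple of ‖h‖ plus a part that the penalty absorbs; a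
square is then completed (`oracle_inequality`).

Noise. A row of Δ(k) is interior if no knot cuts its stencil. The common kernel V of the interior
rows has dimension at most k(s+1); projecting ε onto V gives √(k(s+1)/n) + √(2v/n). Modulo V, h is a
combination of vectors ψ_j orthogonal to V with coefficients (Δ(k)h)_j. Each ψ_j is the shortest
vector dual to row j, so truncated discrete powers give ‖ψ_j‖² ≤ d^(2k-1), where d is the distance
from j to the nearest knot (`exists_interior_decomposition`). A union bound over at most n-k-s
directions produces λ₀(u).

Interpolation. A vector Q with Q = q on S and |Q_j| ≤ 1 - δ(d/n_max)^(k-1/2) off S leaves slack λ(1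
- |Q_j|)|(Δ(k)h)_j| in the penalty, which pays for the noise along ψ_j. There remains ∑ Q_j
(Δ(k)h)_j, bounded by ‖Δᵏ Q‖₂ ‖h‖₂ through summation by parts and Cauchy–Schwarz; thus Γ_S² is n
times a bound for ‖Δᵏ Q‖₂².

Such a Q (`exists_interpolant`) is glued from profiles (α + T)(1 - c·bump), one per segment
(`exists_profile`). The bump behaves like d^(k-1/2) near the knots; its k-th differences are of
order d^(-1/2), and their squares sum to a logarithm. Without a sign change T = 0 and the scale is
n_max. Otherwise T is a smooth transition and the scale is n_i. -/

/-- Every finite partial sum of the squares of `f` is at most `B`. -/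
def SqSumLE (f : ℤ → ℝ) (B : ℝ) : Prop := ∀ s : Finset ℤ, ∑ x ∈ s, f x ^ 2 ≤ B

namespace SqSumLE

variable {f g : ℤ → ℝ} {A B K : ℝ}

lemma nonneg (h : SqSumLE f B) : 0 ≤ B := by simpa using h ∅

lemma mono (h : SqSumLE f A) (hAB : A ≤ B) : SqSumLE f B := fun s => (h s).trans hAB

lemma add (hf : SqSumLE f A) (hg : SqSumLE g B) : SqSumLE (f + g) (2 * (A + B)) := by
  intro s
  calc ∑ x ∈ s, (f + g) x ^ 2 ≤ ∑ x ∈ s, 2 * (f x ^ 2 + g x ^ 2) :=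
        sum_le_sum fun x _ => add_sq_le
    _ = 2 * (∑ x ∈ s, f x ^ 2 + ∑ x ∈ s, g x ^ 2) := by rw [← mul_sum, sum_add_distrib]
    _ ≤ 2 * (A + B) := by linarith [hf s, hg s]

lemma mul_of_abs_le (hf : ∀ x, |f x| ≤ K) (hg : SqSumLE g B) :
    SqSumLE (fun x => f x * g x) (K ^ 2 * B) := by
  intro s
  calc ∑ x ∈ s, (f x * g x) ^ 2 ≤ ∑ x ∈ s, K ^ 2 * g x ^ 2 := by
        refine sum_le_sum fun x _ => ?_
        rw [mul_pow, ← sq_abs (f x)]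
        gcongr
        exact hf x
    _ = K ^ 2 * ∑ x ∈ s, g x ^ 2 := by rw [mul_sum]
    _ ≤ K ^ 2 * B := by gcongr; exact hg s

lemma const_mul (c : ℝ) (hg : SqSumLE g B) : SqSumLE (fun x => c * g x) (c ^ 2 * B) := by
  simpa using mul_of_abs_le (f := fun _ => c) (K := |c|) (fun _ => le_rfl) hg

lemma comp_add (hf : SqSumLE f B) (c : ℤ) : SqSumLE (fun x => f (x + c)) B := by
  intro s
  have := hf (s.map (addRightEmbedding c))
  simpa using this

lemma of_support {s : Finset ℤ} (hf : ∀ x, |f x| ≤ K) (hs : ∀ x ∉ s, f x = 0) :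
    SqSumLE f (#s * K ^ 2) := by
  intro r
  calc ∑ x ∈ r, f x ^ 2 ≤ ∑ x ∈ r ∪ s, f x ^ 2 :=
        sum_le_sum_of_subset_of_nonneg subset_union_left fun _ _ _ => sq_nonneg _
    _ = ∑ x ∈ s, f x ^ 2 := by
        refine (sum_subset subset_union_right fun x _ hx => ?_).symm
        simp [hs x hx]
    _ ≤ ∑ _x ∈ s, K ^ 2 := by
        refine sum_le_sum fun x _ => ?_
        rw [← sq_abs]
        gcongr
        exact hf x
    _ = #s * K ^ 2 := by simp

/-- A discrete Leibniz estimate for the differences of a product. -/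
lemma fwdDiff_iter_mul (p : ℕ) : ∀ {f g : ℤ → ℝ} {B : ℝ},
    (∀ a b, a + b = p → SqSumLE (fun x => (Δ_[1])^[a] f x * (Δ_[1])^[b] g (x + a)) B) →
    SqSumLE ((Δ_[1])^[p] (f * g)) (4 ^ p * B) := by
  induction p with
  | zero =>
    intro f g B h
    simpa [Pi.mul_def] using h 0 0 rfl
  | succ p ih =>
    intro f g B h
    -- Differencing the first factor shifts the second, whence the argument `x + a` in the
    -- hypothesis. Each use of `SqSumLE.add` with two equal bounds costs a factor 4.
    have e : Δ_[1] (f * g) = f * Δ_[1] g + Δ_[1] f * (fun x => g (x + 1)) := by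
      ext x
      simp only [fwdDiff, Pi.mul_apply, Pi.add_apply]
      ring
    rw [Function.iterate_succ_apply, e, fwdDiff_iter_add]
    have h1 : SqSumLE ((Δ_[1])^[p] (f * Δ_[1] g)) (4 ^ p * B) := by
      refine ih fun a b hab => ?_
      have := h a (b + 1) (by omega)
      simpa only [Function.iterate_succ_apply] using this
    have h2 : SqSumLE ((Δ_[1])^[p] (Δ_[1] f * (fun x => g (x + 1)))) (4 ^ p * B) := by
      refine ih fun a b hab => ?_
      have := h (a + 1) b (by omega)
      simp only [Function.iterate_succ_apply] at this
      convert this using 3 with x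
      rw [fwdDiff_iter_comp_add]
      push_cast
      ring_nf
    refine (h1.add h2).mono (le_of_eq ?_)
    ring

end SqSumLE

/-- The `m`-fold summation over `1, …, d` of a sequence. -/
noncomputable def iterSum (f : ℤ → ℝ) : ℕ → ℤ → ℝ
  | 0, d => f d
  | m + 1, d => ∑ j ∈ Icc 1 d, iterSum f m j

section iterSum

variable {f : ℤ → ℝ} (hf : ∀ d ≤ 0, f d = 0)

lemma iterSum_nonneg (hf : ∀ d, 0 ≤ f d) (m : ℕ) (d : ℤ) : 0 ≤ iterSum f m d := by
  induction m generalizing d with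
  | zero => exact hf d
  | succ m ih => exact sum_nonneg fun j _ => ih j

include hf

lemma iterSum_of_nonpos (m : ℕ) {d : ℤ} (hd : d ≤ 0) : iterSum f m d = 0 := by
  cases m with
  | zero => exact hf d hd
  | succ m => simp [iterSum, Icc_eq_empty (show ¬ 1 ≤ d by omega)]

lemma iterSum_succ_add_one (m : ℕ) (d : ℤ) :
    iterSum f (m + 1) (d + 1) = iterSum f (m + 1) d + iterSum f m (d + 1) := by
  rcases lt_or_ge d 0 with hd | hd
  · simp [iterSum_of_nonpos hf _ (show d + 1 ≤ 0 by omega), iterSum_of_nonpos hf _ hd.le]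
  · have : Icc 1 (d + 1) = insert (d + 1) (Icc 1 d) := by
      ext x; simp only [mem_Icc, mem_insert]; omega
    rw [iterSum, iterSum, this, sum_insert (by simp)]
    ring

/-- A difference undoes one summation and shifts the argument by one. Since `f` vanishes on `d ≤ 0`,
this is valid on all of ℤ, also where the sums are empty. -/
lemma fwdDiff_iter_iterSum (m a : ℕ) :
    (Δ_[1])^[a] (iterSum f (m + a)) = fun x => iterSum f m (x + a) := by
  induction a generalizing m with
  | zero => simp
  | succ a ih =>
    rw [Function.iterate_succ_apply', show m + (a + 1) = (m + 1) + a by ring, ih]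
    ext x
    have := iterSum_succ_add_one hf m (x + a)
    simp only [fwdDiff]
    rw [show x + 1 + (a : ℤ) = x + a + 1 by ring, this]
    push_cast
    ring_nf

lemma fwdDiff_iter_iterSum_sub (m b : ℕ) (N : ℤ) :
    (Δ_[1])^[b] (fun x => iterSum f (m + b) (N - x)) =
      fun x => (-1) ^ b * iterSum f m (N - x) := by
  induction b generalizing m with
  | zero => simp
  | succ b ih =>
    rw [Function.iterate_succ_apply', show m + (b + 1) = (m + 1) + b by ring, ih]
    ext x
    have := iterSum_succ_add_one hf m (N - (x + 1))
    rw [show N - (x + 1) + 1 = N - x by ring] at this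
    simp only [fwdDiff]
    rw [this]
    ring

end iterSum

/-- The sequence `d ↦ d ^ (-1/2)` on the positive integers. -/
noncomputable def invSqrt (d : ℤ) : ℝ := if 1 ≤ d then 1 / √(d : ℝ) else 0

lemma invSqrt_of_nonpos (d : ℤ) (hd : d ≤ 0) : invSqrt d = 0 := if_neg (by omega)

/-- The `m`-fold summation of the sequence `d ↦ d ^ (-1/2)`, which grows like `d ^ (m - 1/2)`. -/
noncomputable abbrev rootSum : ℕ → ℤ → ℝ := iterSum invSqrt

lemma rootSum_zero {d : ℤ} (hd : 0 < d) : rootSum 0 d = 1 / √(d : ℝ) := if_pos (by omega)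

lemma rootSum_of_nonpos (m : ℕ) {d : ℤ} (hd : d ≤ 0) : rootSum m d = 0 :=
  iterSum_of_nonpos invSqrt_of_nonpos m hd

lemma rootSum_nonneg (m : ℕ) (d : ℤ) : 0 ≤ rootSum m d :=
  iterSum_nonneg (fun d => by rw [invSqrt]; split_ifs <;> positivity) m d

lemma rootSum_succ_add_one (m : ℕ) (d : ℤ) :
    rootSum (m + 1) (d + 1) = rootSum (m + 1) d + rootSum m (d + 1) :=
  iterSum_succ_add_one invSqrt_of_nonpos m d

/-- One summation telescopes against 1/√(d+1) ≤ 2(√(d+1) - √d); every further one costs at most a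
factor d. -/
lemma rootSum_succ_le (m : ℕ) {d : ℤ} (hd : 0 ≤ d) :
    rootSum (m + 1) d ≤ 2 * (d : ℝ) ^ m * √d := by
  induction m generalizing d with
  | zero =>
    induction d, hd using Int.leInduction with
    | base => simp [rootSum_of_nonpos]
    | succ d hd ih =>
      rw [rootSum_succ_add_one]
      have h1 : (0 : ℝ) ≤ d := by exact_mod_cast hd
      have h2 : 0 < √((d : ℝ) + 1) := by positivity
      have e1 := Real.sq_sqrt h1
      have e2 := Real.sq_sqrt (show 0 ≤ (d : ℝ) + 1 by positivity)
      have : rootSum 0 (d + 1) ≤ 2 * √((d : ℝ) + 1) - 2 * √d := by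
        rw [rootSum_zero (by omega)]
        push_cast
        rw [div_le_iff₀ h2]
        nlinarith [sq_nonneg (√((d : ℝ) + 1) - √d)]
      push_cast
      simp at ih ⊢
      linarith
  | succ m ih =>
    have h1 : (0 : ℝ) ≤ d := by exact_mod_cast hd
    calc rootSum (m + 1 + 1) d ≤ ∑ j ∈ Icc 1 d, 2 * (d : ℝ) ^ m * √d := by
          rw [rootSum, iterSum]
          refine sum_le_sum fun j hj => ?_
          rw [mem_Icc] at hj
          have hj0 : (0 : ℝ) ≤ j := by exact_mod_cast (by omega : 0 ≤ j)
          have hjd : (j : ℝ) ≤ d := by exact_mod_cast hj.2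
          refine (ih (by omega)).trans ?_
          gcongr
      _ = 2 * (d : ℝ) ^ (m + 1) * √d := by
          have : (d.toNat : ℝ) = d := by exact_mod_cast Int.toNat_of_nonneg hd
          simp [Int.card_Icc, this]
          ring

lemma add_one_pow_le (m : ℕ) {x : ℝ} (hx : 0 ≤ x) :
    (x + 1) ^ (m + 1) ≤ x ^ (m + 1) + (m + 1) * (x + 1) ^ m := by
  induction m with
  | zero => simp
  | succ m ih =>
    have h : x ^ (m + 1) ≤ (x + 1) ^ (m + 1) := by gcongr; linarith
    push_cast
    calc (x + 1) ^ (m + 1 + 1) = (x + 1) * (x + 1) ^ (m + 1) := by ring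
      _ ≤ (x + 1) * (x ^ (m + 1) + (m + 1) * (x + 1) ^ m) := by gcongr
      _ = x ^ (m + 1 + 1) + x ^ (m + 1) + (m + 1) * (x + 1) ^ (m + 1) := by ring
      _ ≤ x ^ (m + 1 + 1) + (x + 1) ^ (m + 1) + (m + 1) * (x + 1) ^ (m + 1) := by gcongr
      _ = _ := by ring

/-- Double induction: the increment of d^(m+1) is at most (m+1)(d+1)^m, which the bound for m
compares with the increment of `rootSum (m + 1)`. -/
lemma le_rootSum (m : ℕ) {d : ℤ} (hd : 0 < d) :
    (d : ℝ) ^ m ≤ m.factorial * rootSum m d * √d := by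
  induction m generalizing d with
  | zero =>
    have h : 0 < √(d : ℝ) := Real.sqrt_pos.2 (by exact_mod_cast hd)
    rw [rootSum_zero hd]
    simp [h.ne']
  | succ m ihm =>
    have hd' := hd.le
    clear hd
    induction d, hd' using Int.leInduction with
    | base => simp
    | succ d hd ih =>
      have h1 : (0 : ℝ) ≤ d := by exact_mod_cast hd
      have hm := ihm (show 0 < d + 1 by omega)
      rw [rootSum_succ_add_one]
      push_cast [Nat.factorial_succ] at ih hm ⊢
      have h0 := rootSum_nonneg (m + 1) d
      have hs : √(d : ℝ) ≤ √((d : ℝ) + 1) := Real.sqrt_le_sqrt (by linarith)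
      calc ((d : ℝ) + 1) ^ (m + 1) ≤ (d : ℝ) ^ (m + 1) + (m + 1) * ((d : ℝ) + 1) ^ m :=
            add_one_pow_le m h1
        _ ≤ (m + 1) * m.factorial * rootSum (m + 1) d * √d
            + (m + 1) * (m.factorial * rootSum m (d + 1) * √((d : ℝ) + 1)) := by gcongr
        _ ≤ (m + 1) * m.factorial * rootSum (m + 1) d * √((d : ℝ) + 1)
            + (m + 1) * (m.factorial * rootSum m (d + 1) * √((d : ℝ) + 1)) := by gcongr
        _ = _ := by ring

lemma sq_rootSum_le (m : ℕ) {d : ℤ} (hd : 0 < d) :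
    rootSum m d ^ 2 ≤ 4 * (d : ℝ) ^ (2 * m) / d := by
  have h1 : (0 : ℝ) < d := by exact_mod_cast hd
  rw [le_div_iff₀ h1]
  cases m with
  | zero =>
    rw [rootSum_zero hd, div_pow, Real.sq_sqrt h1.le]
    field_simp
    norm_num
  | succ m =>
    have := rootSum_succ_le m hd.le
    calc rootSum (m + 1) d ^ 2 * d ≤ (2 * (d : ℝ) ^ m * √d) ^ 2 * d := by
          gcongr
          exact rootSum_nonneg _ _
      _ = 4 * (d : ℝ) ^ (2 * (m + 1)) := by
          rw [mul_pow, Real.sq_sqrt h1.le]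
          ring

lemma le_sq_rootSum (m : ℕ) {d : ℤ} (hd : 0 < d) :
    (d : ℝ) ^ (2 * m) / d / (m.factorial : ℝ) ^ 2 ≤ rootSum m d ^ 2 := by
  have h1 : (0 : ℝ) < d := by exact_mod_cast hd
  have := le_rootSum m hd
  rw [div_div, div_le_iff₀ (by positivity)]
  calc (d : ℝ) ^ (2 * m) = ((d : ℝ) ^ m) ^ 2 := by ring
    _ ≤ (m.factorial * rootSum m d * √d) ^ 2 := by gcongr
    _ = _ := by rw [mul_pow, Real.sq_sqrt h1.le]; ring

lemma sum_inv_le (N : ℕ) : ∑ y ∈ Ioo (0 : ℤ) N, (1 / (y : ℝ)) ≤ 1 + Real.log N := by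
  have h := harmonic_le_one_add_log (N - 1)
  have e : ∑ y ∈ Ioo (0 : ℤ) N, (1 / (y : ℝ)) = (harmonic (N - 1) : ℝ) := by
    rw [harmonic]
    push_cast
    symm
    refine sum_bij (fun i _ => (i : ℤ) + 1) ?_ ?_ ?_ ?_
    · intro i hi; simp at hi ⊢; omega
    · intro i _ j _ h; simpa using h
    · intro y hy
      simp at hy
      exact ⟨(y - 1).toNat, by simp; omega, by omega⟩
    · intro i _; push_cast; simp
  rw [e]
  refine h.trans ?_
  rcases Nat.lt_or_ge N 2 with hN | hN
  · interval_cases N <;> simp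
  · gcongr
    · have : 0 < N - 1 := by omega
      exact_mod_cast this
    · omega

/-- The logarithm of the theorem originates here: what is left after bounding the powers by N is
1/(y(N-y)), and partial fractions split it into two harmonic sums. -/
lemma sqSumLE_rootSum_mul (a b N : ℕ) (hN : 0 < N) :
    SqSumLE (fun y => rootSum a y * rootSum b (N - y))
      (32 * (N : ℝ) ^ (2 * (a + b)) / N * (1 + Real.log N)) := by
  have hN' : (0 : ℝ) < N := by exact_mod_cast hN
  have key : ∀ y ∈ Ioo (0 : ℤ) N, (rootSum a y * rootSum b (N - y)) ^ 2 ≤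
      16 * (N : ℝ) ^ (2 * (a + b)) / N * (1 / (y : ℝ) + 1 / ((N - y : ℤ) : ℝ)) := by
    intro y hy
    rw [mem_Ioo] at hy
    have h1 : (0 : ℝ) < y := by exact_mod_cast hy.1
    have h2 : (0 : ℝ) < ((N - y : ℤ) : ℝ) := by exact_mod_cast (by omega : 0 < (N : ℤ) - y)
    have h3 : (y : ℝ) ≤ N := by exact_mod_cast hy.2.le
    have h4 : ((N - y : ℤ) : ℝ) ≤ N := by exact_mod_cast (by omega : (N : ℤ) - y ≤ N)
    have e : (N : ℝ) = y + ((N - y : ℤ) : ℝ) := by push_cast; ring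
    calc (rootSum a y * rootSum b (N - y)) ^ 2
        = rootSum a y ^ 2 * rootSum b (N - y) ^ 2 := by ring
      _ ≤ (4 * (y : ℝ) ^ (2 * a) / y) *
          (4 * ((N - y : ℤ) : ℝ) ^ (2 * b) / ((N - y : ℤ) : ℝ)) := by
          gcongr
          · exact sq_rootSum_le a hy.1
          · exact sq_rootSum_le b (by omega)
      _ ≤ (4 * (N : ℝ) ^ (2 * a) / y) * (4 * (N : ℝ) ^ (2 * b) / ((N - y : ℤ) : ℝ)) := by
          gcongr
      _ = 16 * (N : ℝ) ^ (2 * (a + b)) * (1 / (y * ((N - y : ℤ) : ℝ))) := by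
          field_simp; ring
      _ = _ := by
          have : 1 / (y * ((N - y : ℤ) : ℝ)) = 1 / N * (1 / (y : ℝ) + 1 / ((N - y : ℤ) : ℝ)) := by
            rw [div_add_div _ _ h1.ne' h2.ne', one_mul, mul_one, add_comm, ← e]
            field_simp
          rw [this]; ring
  have hrefl : ∑ y ∈ Ioo (0 : ℤ) N, (1 / ((N - y : ℤ) : ℝ)) = ∑ y ∈ Ioo (0 : ℤ) N, (1 / (y : ℝ)) := by
    refine sum_bij (fun y _ => N - y) ?_ ?_ ?_ ?_
    · intro y hy; simp at hy ⊢; omega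
    · intro y _ z _ h; omega
    · intro y hy; simp at hy; exact ⟨N - y, by simp; omega, by omega⟩
    · intro y _; rfl
  intro s
  calc ∑ y ∈ s, (rootSum a y * rootSum b (N - y)) ^ 2
      ≤ ∑ y ∈ s ∪ Ioo (0 : ℤ) N, (rootSum a y * rootSum b (N - y)) ^ 2 :=
        sum_le_sum_of_subset_of_nonneg subset_union_left fun _ _ _ => sq_nonneg _
    _ = ∑ y ∈ Ioo (0 : ℤ) N, (rootSum a y * rootSum b (N - y)) ^ 2 := by
        refine (sum_subset subset_union_right fun y _ hy => ?_).symm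
        rw [mem_Ioo, not_and_or, not_lt, not_lt] at hy
        rcases hy with hy | hy
        · simp [rootSum_of_nonpos a hy]
        · simp [rootSum_of_nonpos b (show (N : ℤ) - y ≤ 0 by omega)]
    _ ≤ ∑ y ∈ Ioo (0 : ℤ) N,
          16 * (N : ℝ) ^ (2 * (a + b)) / N * (1 / (y : ℝ) + 1 / ((N - y : ℤ) : ℝ)) :=
        sum_le_sum key
    _ = 32 * (N : ℝ) ^ (2 * (a + b)) / N * ∑ y ∈ Ioo (0 : ℤ) N, (1 / (y : ℝ)) := by
        rw [← mul_sum, sum_add_distrib, hrefl]; ring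
    _ ≤ _ := by gcongr; exact sum_inv_le N

/-- The differences of the product of two opposite `rootSum` sequences. -/
lemma sqSumLE_fwdDiff_iter_bump (k p N : ℕ) (hp : p ≤ k) (hN : 0 < N) :
    SqSumLE ((Δ_[1])^[p] ((rootSum k) * fun x => rootSum k (N - x)))
      (4 ^ p * (32 * (N : ℝ) ^ (2 * (2 * k - p)) / N * (1 + Real.log N))) := by
  refine SqSumLE.fwdDiff_iter_mul p fun a b hab => ?_
  -- With `a` differences on the left factor and `b` on the right one, `rootSum a'` and `rootSum b'`
  -- remain, and a' + b' = 2k - p.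
  obtain ⟨a', rfl⟩ : ∃ a', k = a' + a := ⟨k - a, by omega⟩
  obtain ⟨b', hb'⟩ : ∃ b', a' + a = b' + b := ⟨a' + a - b, by omega⟩
  rw [fwdDiff_iter_iterSum invSqrt_of_nonpos]
  have := fwdDiff_iter_iterSum_sub invSqrt_of_nonpos b' b N
  rw [← hb'] at this
  rw [this]
  have h := ((sqSumLE_rootSum_mul a' b' N hN).comp_add a).const_mul ((-1) ^ b)
  rw [← pow_mul, mul_comm b 2, pow_mul, neg_one_sq, one_pow, one_mul] at h
  rw [show 2 * (a' + a) - p = a' + b' by omega]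
  convert h using 2
  ring

end TrendFilter

/-! ### Moving averages and smooth transitions. -/

namespace TrendFilter

open Finset fwdDiff

/-- The moving average of length `m`. -/
noncomputable def movAvg (m : ℕ) (f : ℤ → ℝ) : ℤ → ℝ := fun x => (∑ j ∈ range m, f (x - j)) / m

lemma fwdDiff_movAvg (m : ℕ) (f : ℤ → ℝ) :
    Δ_[1] (movAvg m f) = fun x => (f (x + 1) - f (x + 1 - m)) / m := by
  ext x
  simp only [fwdDiff, movAvg]
  rw [← sub_div, ← sum_sub_distrib]
  have := sum_range_sub' (fun j : ℕ => f (x + 1 - j)) m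
  simp only [Nat.cast_zero, sub_zero] at this
  rw [← this]
  congr 1
  refine sum_congr rfl fun j _ => ?_
  push_cast
  ring_nf

lemma commute_fwdDiff_movAvg (m : ℕ) :
    Function.Commute (fwdDiff (1 : ℤ) : (ℤ → ℝ) → (ℤ → ℝ)) (movAvg m) := by
  intro f
  ext x
  simp only [fwdDiff, movAvg]
  rw [← sub_div, ← sum_sub_distrib]
  congr 1
  refine sum_congr rfl fun j _ => ?_
  ring_nf

lemma movAvg_mem_Icc {m : ℕ} {f : ℤ → ℝ} {a b : ℝ} (hm : 0 < m) {x : ℤ}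
    (hf : ∀ j < m, f (x - j) ∈ Set.Icc a b) : movAvg m f x ∈ Set.Icc a b := by
  have hm' : (0 : ℝ) < m := by exact_mod_cast hm
  rw [movAvg, Set.mem_Icc, le_div_iff₀ hm', div_le_iff₀ hm']
  constructor
  · simpa [mul_comm] using
      card_nsmul_le_sum (range m) (fun j => f (x - j)) a fun j hj => (hf j (mem_range.1 hj)).1
  · simpa [mul_comm] using
      sum_le_card_nsmul (range m) (fun j => f (x - j)) b fun j hj => (hf j (mem_range.1 hj)).2

lemma abs_movAvg_le {m : ℕ} {f : ℤ → ℝ} {K : ℝ} (hm : 0 < m) (hf : ∀ x, |f x| ≤ K) (x : ℤ) :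
    |movAvg m f x| ≤ K :=
  abs_le.2 (movAvg_mem_Icc hm fun _ _ => abs_le.1 (hf _))

lemma abs_movAvg_iter_le {m : ℕ} {f : ℤ → ℝ} {K : ℝ} (hm : 0 < m) (hf : ∀ x, |f x| ≤ K) (j : ℕ) :
    ∀ x : ℤ, |(movAvg m)^[j] f x| ≤ K := by
  induction j with
  | zero => exact hf
  | succ j ih => rw [Function.iterate_succ_apply']; exact abs_movAvg_le hm ih

/-- Each difference is paired with one average; there the sum telescopes to two terms over m, a
factor 2/m. -/
lemma abs_fwdDiff_iter_movAvg_iter_le {m : ℕ} (hm : 0 < m) (l : ℕ) : ∀ {j : ℕ} {f : ℤ → ℝ} {K : ℝ},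
    l ≤ j → (∀ x, |f x| ≤ K) → ∀ x, |(Δ_[1])^[l] ((movAvg m)^[j] f) x| ≤ (2 / m) ^ l * K := by
  induction l with
  | zero => intro j f K _ hf x; simpa using abs_movAvg_iter_le hm hf j x
  | succ l ih =>
    intro j f K hj hf x
    obtain ⟨j, rfl⟩ : ∃ i, j = i + 1 := ⟨j - 1, by omega⟩
    have hm' : (0 : ℝ) < m := by exact_mod_cast hm
    rw [Function.iterate_succ_apply, Function.iterate_succ_apply (movAvg m),
      (commute_fwdDiff_movAvg m).iterate_right j (movAvg m f)]
    have h : ∀ x, |Δ_[1] (movAvg m f) x| ≤ 2 / m * K := by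
      intro x
      rw [fwdDiff_movAvg, abs_div, abs_of_pos hm', div_le_iff₀ hm']
      have e : 2 / (m : ℝ) * K * m = K + K := by field_simp; ring
      rw [e]
      exact (abs_sub _ _).trans (add_le_add (hf _) (hf _))
    refine (ih (by omega) h x).trans (le_of_eq ?_)
    ring

/-- The unit step at `1`. -/
noncomputable def unitStep (x : ℤ) : ℝ := if 1 ≤ x then 1 else 0

/-- A transition from `0` to `1` on `{0, …, N}` with controlled differences up to order `k`. -/
noncomputable def smoothStep (k N : ℕ) : ℤ → ℝ := (movAvg (N / k))^[k] unitStep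

lemma movAvg_iter_unitStep_of_nonpos {m : ℕ} (hm : 0 < m) (j : ℕ) {x : ℤ} (hx : x ≤ 0) :
    (movAvg m)^[j] unitStep x = 0 := by
  induction j generalizing x with
  | zero => simp [unitStep]; omega
  | succ j ih =>
    rw [Function.iterate_succ_apply']
    have := movAvg_mem_Icc (a := 0) (b := 0) (f := (movAvg m)^[j] unitStep) hm (x := x)
      fun i _ => by rw [ih (by omega)]; simp
    exact le_antisymm this.2 this.1

lemma movAvg_iter_unitStep_of_ge {m : ℕ} (hm : 0 < m) (j : ℕ) {x : ℤ}
    (hx : 1 + j * ((m : ℤ) - 1) ≤ x) : (movAvg m)^[j] unitStep x = 1 := by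
  induction j generalizing x with
  | zero => simp at hx; simp [unitStep, hx]
  | succ j ih =>
    rw [Function.iterate_succ_apply']
    have := movAvg_mem_Icc (a := 1) (b := 1) (f := (movAvg m)^[j] unitStep) hm (x := x)
      fun i hi => by
        rw [ih]
        · simp
        · push_cast at hx; linarith [(by exact_mod_cast hi : (i : ℤ) + 1 ≤ m)]
    exact le_antisymm this.2 this.1

lemma movAvg_iter_unitStep_mem {m : ℕ} (hm : 0 < m) (j : ℕ) (x : ℤ) :
    (movAvg m)^[j] unitStep x ∈ Set.Icc (0 : ℝ) 1 := by
  induction j generalizing x with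
  | zero => simp only [Function.iterate_zero, id, unitStep]; split_ifs <;> simp
  | succ j ih =>
    rw [Function.iterate_succ_apply']
    exact movAvg_mem_Icc hm fun i _ => ih _

section smoothStep

variable {k N : ℕ} (hk : 0 < k) (hN : k ≤ N)
include hk hN

lemma smoothStep_of_nonpos {x : ℤ} (hx : x ≤ 0) : smoothStep k N x = 0 :=
  movAvg_iter_unitStep_of_nonpos (Nat.div_pos hN hk) k hx

/-- Each average of length m delays completion by m - 1, and 1 + k(m-1) ≤ N for m = ⌊N/k⌋. -/
lemma smoothStep_of_ge {x : ℤ} (hx : N ≤ x) : smoothStep k N x = 1 := by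
  refine movAvg_iter_unitStep_of_ge (Nat.div_pos hN hk) k ?_
  have h : (k : ℤ) * (N / k : ℕ) ≤ N := by exact_mod_cast Nat.mul_div_le N k
  rw [mul_sub]
  have : (1 : ℤ) ≤ k := by exact_mod_cast hk
  linarith

lemma smoothStep_mem (x : ℤ) : smoothStep k N x ∈ Set.Icc (0 : ℝ) 1 :=
  movAvg_iter_unitStep_mem (Nat.div_pos hN hk) k x

lemma abs_fwdDiff_iter_smoothStep_le {l : ℕ} (hl : l ≤ k) (x : ℤ) :
    |(Δ_[1])^[l] (smoothStep k N) x| ≤ (4 * k / N) ^ l := by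
  have hm : 0 < N / k := Nat.div_pos hN hk
  have h1 : ∀ x, |unitStep x| ≤ 1 := fun x => by simp only [unitStep]; split_ifs <;> simp
  refine (abs_fwdDiff_iter_movAvg_iter_le hm l hl h1 x).trans ?_
  rw [mul_one]
  have hN0 : (0 : ℝ) < N := by exact_mod_cast hk.trans_le hN
  have hm' : (0 : ℝ) < (N / k : ℕ) := by exact_mod_cast hm
  -- Rounding N/k down loses at most a factor 2.
  have key : (N : ℝ) ≤ 2 * k * (N / k : ℕ) := by
    have h2 := Nat.div_add_mod N k
    have h3 := Nat.mod_lt N hk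
    have : N ≤ 2 * k * (N / k) := by nlinarith
    exact_mod_cast this
  refine pow_le_pow_left₀ (by positivity) ?_ l
  rw [div_le_div_iff₀ hm' hN0]
  linarith

end smoothStep

lemma fwdDiff_iter_eq_zero_of_const {k : ℕ} (hk : 0 < k) {f : ℤ → ℝ} {c : ℝ} {x : ℤ}
    (h : ∀ y, x ≤ y → y ≤ x + k → f y = c) : (Δ_[1])^[k] f x = 0 := by
  have e : (Δ_[1])^[k] f x = (Δ_[1])^[k] (fun _ => c) x := by
    rw [fwdDiff_iter_eq_sum_shift, fwdDiff_iter_eq_sum_shift]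
    refine sum_congr rfl fun i hi => ?_
    rw [mem_range] at hi
    rw [h]
    · simp
    · simp; omega
  rw [e]
  obtain ⟨k, rfl⟩ : ∃ i, k = i + 1 := ⟨k - 1, by omega⟩
  rw [Function.iterate_succ_apply, fwdDiff_const, Function.iterate_fixed (fwdDiff_const 1 (0 : ℝ))]

/-- The step is constant on either side of the transition, so at most N + k - 1 ≤ 2N differences are
nonzero. -/
lemma sqSumLE_fwdDiff_iter_smoothStep {k N : ℕ} (hk : 0 < k) (hN : k ≤ N) :
    SqSumLE ((Δ_[1])^[k] (smoothStep k N)) (2 * (16 * k ^ 2) ^ k * N / N ^ (2 * k)) := by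
  have hN0 : (0 : ℝ) < N := by exact_mod_cast hk.trans_le hN
  have h := SqSumLE.of_support (f := (Δ_[1])^[k] (smoothStep k N)) (K := (4 * k / N) ^ k)
    (s := Ioo (-k : ℤ) N) (abs_fwdDiff_iter_smoothStep_le hk hN le_rfl) ?_
  · refine h.mono ?_
    have hc : (#(Ioo (-k : ℤ) N) : ℝ) ≤ 2 * N := by
      rw [Int.card_Ioo]
      exact_mod_cast (by omega : ((N : ℤ) - -k - 1).toNat ≤ 2 * N)
    calc (#(Ioo (-k : ℤ) N) : ℝ) * ((4 * k / N : ℝ) ^ k) ^ 2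
        ≤ 2 * N * ((4 * k / N : ℝ) ^ k) ^ 2 := by
          gcongr
      _ = 2 * (16 * (k : ℝ) ^ 2) ^ k * N / N ^ (2 * k) := by
          rw [← pow_mul, mul_comm k 2, pow_mul, div_pow, div_pow, ← pow_mul (N : ℝ) 2 k, mul_pow]
          norm_num
          ring
  · intro x hx
    rw [mem_Ioo, not_and_or, not_lt, not_lt] at hx
    rcases hx with hx | hx
    · exact fwdDiff_iter_eq_zero_of_const hk fun y _ hy => smoothStep_of_nonpos hk hN (by omega)
    · exact fwdDiff_iter_eq_zero_of_const hk fun y hy _ => smoothStep_of_ge hk hN (by omega)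

/-- The powers of N balance in every Leibniz term: N^(-2a) · N^(2(2k-b)) = N^(2k) when a + b = k.
The step thus worsens the bound for the bump only by a constant. -/
lemma sqSumLE_fwdDiff_iter_smoothStep_mul {k N : ℕ} (hk : 0 < k) (hN : k ≤ N) :
    SqSumLE ((Δ_[1])^[k] (smoothStep k N * (rootSum k * fun x => rootSum k (N - x))))
      (4 ^ k * ((16 * k ^ 2) ^ k * (32 * (N : ℝ) ^ (2 * k) / N * (1 + Real.log N)))) := by
  have hN0 : (0 : ℝ) < N := by exact_mod_cast hk.trans_le hN
  have hlog : 0 ≤ Real.log N := Real.log_natCast_nonneg N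
  refine SqSumLE.fwdDiff_iter_mul k fun a b hab => ?_
  have h := SqSumLE.mul_of_abs_le (abs_fwdDiff_iter_smoothStep_le hk hN (show a ≤ k by omega))
    ((sqSumLE_fwdDiff_iter_bump k b N (by omega) (by omega)).comp_add a)
  refine h.mono ?_
  have e : ((4 * k / N : ℝ) ^ a) ^ 2 * (N : ℝ) ^ (2 * (2 * k - b)) =
      (16 * k ^ 2) ^ a * (N : ℝ) ^ (2 * k) := by
    rw [show 2 * (2 * k - b) = 2 * k + 2 * a by omega, pow_add, div_pow, div_pow, ← pow_mul,
      mul_comm a 2, pow_mul, mul_pow]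
    field_simp
    norm_num
    ring
  have h4 : (16 * (k : ℝ) ^ 2) ^ a * 4 ^ b ≤ (16 * (k : ℝ) ^ 2) ^ k := by
    rw [← hab, pow_add]
    have : (1 : ℝ) ≤ k := by exact_mod_cast hk
    gcongr
    rw [hab]
    nlinarith
  calc ((4 * k / N : ℝ) ^ a) ^ 2 *
        (4 ^ b * (32 * (N : ℝ) ^ (2 * (2 * k - b)) / N * (1 + Real.log N)))
      = (((4 * k / N : ℝ) ^ a) ^ 2 * (N : ℝ) ^ (2 * (2 * k - b))) * 4 ^ b * 32 / N *
        (1 + Real.log N) := by ring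
    _ = ((16 * (k : ℝ) ^ 2) ^ a * 4 ^ b) * (32 * (N : ℝ) ^ (2 * k) / N * (1 + Real.log N)) := by
        rw [e]; ring
    _ ≤ _ := by gcongr

end TrendFilter

/-! ### The profile on a single segment. -/

namespace TrendFilter

open Finset fwdDiff

/-- The unnormalized bump on `{0, …, N}`. -/
noncomputable def bump (k N : ℕ) : ℤ → ℝ := rootSum k * fun x => rootSum k (N - x)

lemma bump_nonneg (k N : ℕ) (x : ℤ) : 0 ≤ bump k N x :=
  mul_nonneg (rootSum_nonneg _ _) (rootSum_nonneg _ _)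

lemma bump_of_nonpos (k N : ℕ) {x : ℤ} (hx : x ≤ 0) : bump k N x = 0 := by
  simp [bump, rootSum_of_nonpos k hx]

lemma bump_of_ge (k N : ℕ) {x : ℤ} (hx : N ≤ x) : bump k N x = 0 := by
  simp [bump, rootSum_of_nonpos k (show (N : ℤ) - x ≤ 0 by omega)]

lemma pow_two_mul_div {k : ℕ} (hk : 0 < k) (x : ℝ) : x ^ (2 * k) / x = x ^ (2 * k - 1) := by
  rcases eq_or_ne x 0 with rfl | hx
  · simp [show 2 * k - 1 ≠ 0 by omega]
  · rw [div_eq_iff hx, ← pow_succ]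
    congr 1
    omega

lemma sq_bump_le {k N : ℕ} (hk : 0 < k) (x : ℤ) :
    bump k N x ^ 2 ≤ 16 * ((N : ℝ) * N) ^ (2 * k - 1) := by
  rcases le_or_gt x 0 with h0 | h0
  · rw [bump_of_nonpos k N h0, zero_pow two_ne_zero]; positivity
  rcases le_or_gt (N : ℤ) x with h1 | h1
  · rw [bump_of_ge k N h1, zero_pow two_ne_zero]; positivity
  have hx0 : (0 : ℝ) < x := by exact_mod_cast h0
  have hx1 : (x : ℝ) < N := by exact_mod_cast h1
  have e1 := sq_rootSum_le k h0
  have e2 := sq_rootSum_le k (show 0 < (N : ℤ) - x by omega)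
  push_cast at e2
  rw [mul_div_assoc, pow_two_mul_div hk] at e1 e2
  calc bump k N x ^ 2 = rootSum k x ^ 2 * rootSum k (N - x) ^ 2 := by
        simp only [bump, Pi.mul_apply]; ring
    _ ≤ (4 * (x : ℝ) ^ (2 * k - 1)) * (4 * ((N : ℝ) - x) ^ (2 * k - 1)) := by gcongr
    _ ≤ (4 * (N : ℝ) ^ (2 * k - 1)) * (4 * (N : ℝ) ^ (2 * k - 1)) := by
        have : 0 ≤ (N : ℝ) - x := by linarith
        gcongr
        linarith
    _ = _ := by rw [mul_pow]; ring

lemma le_sq_bump {k N : ℕ} (hk : 0 < k) {x : ℤ} (h0 : 0 < x) (h1 : x < N) :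
    ((x : ℝ) * (N - x)) ^ (2 * k - 1) / (k.factorial : ℝ) ^ 4 ≤ bump k N x ^ 2 := by
  have e1 := le_sq_rootSum k h0
  have e2 := le_sq_rootSum k (show 0 < (N : ℤ) - x by omega)
  have hx0 : (0 : ℝ) < x := by exact_mod_cast h0
  have hx1 : (0 : ℝ) < N - x := by
    have : (x : ℝ) < N := by exact_mod_cast h1
    linarith
  push_cast at e2
  rw [pow_two_mul_div hk] at e1 e2
  calc ((x : ℝ) * (N - x)) ^ (2 * k - 1) / (k.factorial : ℝ) ^ 4
      = ((x : ℝ) ^ (2 * k - 1) / (k.factorial : ℝ) ^ 2) *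
        (((N : ℝ) - x) ^ (2 * k - 1) / (k.factorial : ℝ) ^ 2) := by
        rw [mul_pow, div_mul_div_comm, ← pow_add]
    _ ≤ rootSum k x ^ 2 * rootSum k (N - x) ^ 2 := by gcongr
    _ = _ := by simp only [bump, Pi.mul_apply]; ring

/-- The factor of `bump` in the interpolating profile. -/
noncomputable def bumpScale (k N M : ℕ) : ℝ := 1 / (4 * √(((N : ℝ) * M) ^ (2 * k - 1)))

lemma sq_bumpScale (k N M : ℕ) : bumpScale k N M ^ 2 = 1 / (16 * ((N : ℝ) * M) ^ (2 * k - 1)) := by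
  rw [bumpScale, div_pow, mul_pow, Real.sq_sqrt (by positivity)]
  norm_num

lemma bumpScale_nonneg (k N M : ℕ) : 0 ≤ bumpScale k N M := by rw [bumpScale]; positivity

lemma bumpScale_mul_bump_le_one {k N M : ℕ} (hk : 0 < k) (hN : 0 < N) (hM : N ≤ M) (x : ℤ) :
    bumpScale k N M * bump k N x ≤ 1 := by
  have hM0 : 0 < M := by omega
  refine le_of_sq_le_sq ?_ zero_le_one
  rw [mul_pow, sq_bumpScale, one_pow, one_div_mul_eq_div, div_le_one (by positivity)]
  refine (sq_bump_le hk x).trans ?_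
  gcongr

/-- The endpoint farther from x is at distance at least N/2, so min(x, N-x) · N ≤ 2x(N-x); dividing
by NM leaves min(x, N-x)/M. -/
lemma le_bumpScale_mul_bump {k N M : ℕ} (hk : 0 < k) (hM : N ≤ M) {x : ℤ} (h0 : 0 < x)
    (h1 : x < N) :
    1 / (4 * 2 ^ k * (k.factorial : ℝ) ^ 2) *
        √(((min x (N - x) : ℤ) / M : ℝ) ^ (2 * k - 1)) ≤ bumpScale k N M * bump k N x := by
  have hN0 : (0 : ℝ) < N := by exact_mod_cast (by omega : 0 < N)
  have hM0 : (0 : ℝ) < M := by exact_mod_cast (by omega : 0 < M)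
  have hx0 : (0 : ℝ) < x := by exact_mod_cast h0
  have hx1 : (0 : ℝ) < N - x := by
    have : (x : ℝ) < N := by exact_mod_cast h1
    linarith
  set z : ℝ := ((min x (N - x) : ℤ) : ℝ) with hz
  have hz0 : 0 < z := by rw [hz]; exact_mod_cast (by omega : 0 < min x ((N : ℤ) - x))
  have hzN : z * N ≤ 2 * (x * (N - x)) := by
    have : z = min (x : ℝ) (N - x) := by rw [hz]; push_cast; rfl
    rw [this]
    rcases le_total (x : ℝ) (N - x) with h | h
    · rw [min_eq_left h]; nlinarith
    · rw [min_eq_right h]; nlinarith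
  refine le_of_sq_le_sq ?_ (mul_nonneg (bumpScale_nonneg _ _ _) (bump_nonneg _ _ _))
  rw [mul_pow, Real.sq_sqrt (by positivity), mul_pow, sq_bumpScale]
  have key : (z / M) ^ (2 * k - 1) ≤ 4 ^ k * ((x * (N - x)) / (N * M)) ^ (2 * k - 1) := by
    have : z / M ≤ 2 * ((x * (N - x)) / (N * M)) := by
      rw [← mul_div_assoc, div_le_div_iff₀ hM0 (by positivity)]
      nlinarith
    calc (z / M) ^ (2 * k - 1) ≤ (2 * (((x : ℝ) * (N - x)) / (N * M))) ^ (2 * k - 1) := by gcongr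
      _ = 2 ^ (2 * k - 1) * (((x : ℝ) * (N - x)) / (N * M)) ^ (2 * k - 1) := mul_pow _ _ _
      _ ≤ 2 ^ (2 * k) * (((x : ℝ) * (N - x)) / (N * M)) ^ (2 * k - 1) := by
          gcongr
          · norm_num
          · omega
      _ = _ := by rw [pow_mul]; norm_num
  calc (1 / (4 * 2 ^ k * (k.factorial : ℝ) ^ 2)) ^ 2 * (z / M) ^ (2 * k - 1)
      ≤ (1 / (4 * 2 ^ k * (k.factorial : ℝ) ^ 2)) ^ 2 *
          (4 ^ k * ((x * (N - x)) / (N * M)) ^ (2 * k - 1)) := by gcongr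
    _ = 1 / (16 * ((N : ℝ) * M) ^ (2 * k - 1)) *
          (((x : ℝ) * (N - x)) ^ (2 * k - 1) / (k.factorial : ℝ) ^ 4) := by
        have : (4 : ℝ) ^ k = (2 ^ k) ^ 2 := by rw [← pow_mul, mul_comm, pow_mul]; norm_num
        rw [this, div_pow ((x : ℝ) * (N - x))]
        generalize ((x : ℝ) * (N - x)) ^ (2 * k - 1) = X
        field_simp
        ring
    _ ≤ _ := by gcongr; exact le_sq_bump hk h0 h1

lemma sqSumLE_fwdDiff_iter_bump_scaled {k N M : ℕ} (hk : 0 < k) (hN : 0 < N) (hM : 0 < M)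
    {h : ℤ → ℝ} {c K : ℝ}
    (hh : SqSumLE ((Δ_[1])^[k] h) (K * (32 * (N : ℝ) ^ (2 * k) / N * (1 + Real.log N)))) :
    SqSumLE ((Δ_[1])^[k] ((c * bumpScale k N M) • h))
      (c ^ 2 * (2 * K * ((1 + Real.log N) / (M : ℝ) ^ (2 * k - 1)))) := by
  have hN0 : (0 : ℝ) < N := by exact_mod_cast hN
  have hM0 : (0 : ℝ) < M := by exact_mod_cast hM
  rw [fwdDiff_iter_const_smul]
  refine (hh.const_mul (c * bumpScale k N M)).mono (le_of_eq ?_)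
  rw [mul_pow, sq_bumpScale, mul_div_assoc, pow_two_mul_div hk, mul_pow]
  field_simp
  ring

/-- Equal end values need no transition (T = 0), so M is free. Otherwise T is a multiple of
`smoothStep`, whose square sum is of order N^(1-2k); this forces M = N. -/
lemma exists_transition {k N M : ℕ} {α β : ℝ} (hk : 0 < k) (hN : 0 < N)
    (hα : |α| ≤ 1) (hβ : |β| ≤ 1) (h : α = β ∨ M = N ∧ k ≤ N) :
    ∃ T : ℤ → ℝ, (∀ x ≤ 0, T x = 0) ∧ (∀ x, (N : ℤ) ≤ x → T x = β - α) ∧ (∀ x, |α + T x| ≤ 1) ∧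
      SqSumLE ((Δ_[1])^[k] T) (8 * (16 * (k : ℝ) ^ 2) ^ k * ((1 + Real.log N) / (M : ℝ) ^ (2 * k - 1))) ∧
      SqSumLE ((Δ_[1])^[k] (T * bump k N))
        (4 * (4 ^ k * (16 * (k : ℝ) ^ 2) ^ k) * (32 * (N : ℝ) ^ (2 * k) / N * (1 + Real.log N))) := by
  have hN0 : (0 : ℝ) < N := by exact_mod_cast hN
  have hlog : 0 ≤ Real.log N := Real.log_natCast_nonneg N
  rcases h with rfl | ⟨rfl, hkN⟩
  · have hz : (Δ_[1])^[k] (0 : ℤ → ℝ) = 0 := Function.iterate_fixed (fwdDiff_const 1 (0 : ℝ)) k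
    refine ⟨0, by simp, by simp, by simpa using hα, ?_, ?_⟩
    · intro s
      rw [hz]
      simp
      positivity
    · intro s
      rw [zero_mul, hz]
      simp
      positivity
  · have ha : (β - α) ^ 2 ≤ 4 := by
      rw [abs_le] at hα hβ
      nlinarith [hα.1, hα.2, hβ.1, hβ.2]
    refine ⟨(β - α) • smoothStep k M, ?_, ?_, ?_, ?_, ?_⟩
    · intro x hx; simp [smoothStep_of_nonpos hk hkN hx]
    · intro x hx; simp [smoothStep_of_ge hk hkN hx]
    · intro x
      obtain ⟨h0, h1⟩ := smoothStep_mem hk hkN x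
      rw [abs_le] at hα hβ ⊢
      simp only [Pi.smul_apply, smul_eq_mul]
      constructor <;> nlinarith [hα.1, hα.2, hβ.1, hβ.2]
    · rw [fwdDiff_iter_const_smul]
      refine ((sqSumLE_fwdDiff_iter_smoothStep hk hkN).const_mul (β - α)).mono ?_
      have e : 2 * (16 * (k : ℝ) ^ 2) ^ k * M / M ^ (2 * k) =
          2 * (16 * (k : ℝ) ^ 2) ^ k * (1 / (M : ℝ) ^ (2 * k - 1)) := by
        rw [← pow_two_mul_div hk (M : ℝ)]
        field_simp
      rw [e]
      calc (β - α) ^ 2 * (2 * (16 * (k : ℝ) ^ 2) ^ k * (1 / (M : ℝ) ^ (2 * k - 1)))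
          ≤ 4 * (2 * (16 * (k : ℝ) ^ 2) ^ k * ((1 + Real.log M) / (M : ℝ) ^ (2 * k - 1))) := by
            gcongr
            linarith
        _ = _ := by ring
    · rw [smul_mul_assoc, fwdDiff_iter_const_smul]
      refine ((sqSumLE_fwdDiff_iter_smoothStep_mul hk hkN).const_mul (β - α)).mono ?_
      calc (β - α) ^ 2 * (4 ^ k * ((16 * (k : ℝ) ^ 2) ^ k * (32 * (M : ℝ) ^ (2 * k) / M * (1 + Real.log M))))
          ≤ 4 * (4 ^ k * ((16 * (k : ℝ) ^ 2) ^ k * (32 * (M : ℝ) ^ (2 * k) / M * (1 + Real.log M)))) := by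
            gcongr
        _ = _ := by ring

/-- A sequence joining `α` to `β` on `{0, …, N}`, staying away from `±1` at a rate of order
`(d / M) ^ (k - 1/2)` at distance `d` from the endpoints, with small `k`-th order differences. -/
lemma exists_profile (k : ℕ) (hk : 0 < k) : ∃ C δ : ℝ, 0 < C ∧ 0 < δ ∧
    ∀ (N M : ℕ) (α β : ℝ), 0 < N → N ≤ M → |α| ≤ 1 → |β| ≤ 1 → (α = β ∨ M = N ∧ k ≤ N) →
    ∃ F : ℤ → ℝ, (∀ x ≤ 0, F x = α) ∧ (∀ x, (N : ℤ) ≤ x → F x = β) ∧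
      (∀ x : ℤ, 0 < x → x < N → |F x| ≤ 1 - δ * √(((min x (N - x) : ℤ) / M : ℝ) ^ (2 * k - 1))) ∧
      SqSumLE ((Δ_[1])^[k] F) (C * ((1 + Real.log N) / (M : ℝ) ^ (2 * k - 1))) := by
  -- C collects the bounds of the three nonconstant summands of F below, through two uses of
  -- `SqSumLE.add`; δ is the constant of `le_bumpScale_mul_bump`.
  refine ⟨2 * (2 * (8 * (16 * (k : ℝ) ^ 2) ^ k + 2 * 4 ^ k)
    + 2 * (4 * (4 ^ k * (16 * (k : ℝ) ^ 2) ^ k))), 1 / (4 * 2 ^ k * (k.factorial : ℝ) ^ 2),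
    by positivity, by positivity, ?_⟩
  intro N M α β hN hM hα hβ h
  obtain ⟨T, hT0, hT1, hT, hΔ, hΔb⟩ := exists_transition (M := M) hk hN hα hβ h
  have hb : SqSumLE ((Δ_[1])^[k] (bump k N)) _ := sqSumLE_fwdDiff_iter_bump k k N le_rfl hN
  rw [show 2 * k - k = k by omega] at hb
  have hb1 := sqSumLE_fwdDiff_iter_bump_scaled (c := -α) hk hN (hN.trans_le hM) hb
  have hb2 := sqSumLE_fwdDiff_iter_bump_scaled (c := -1) hk hN (hN.trans_le hM) hΔb
  -- This is (α + T)(1 - bumpScale · bump), expanded into summands with known differences. The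
  -- product form gives the slack, as |α + T| ≤ 1.
  refine ⟨(fun _ => α) + (T + (-α * bumpScale k N M) • bump k N
    + (-1 * bumpScale k N M) • (T * bump k N)), ?_, ?_, ?_, ?_⟩
  · intro x hx
    simp [hT0 x hx, bump_of_nonpos k N hx]
  · intro x hx
    simp [hT1 x hx, bump_of_ge k N hx]
  · intro x h0 h1
    have e : ((fun _ : ℤ => α) + (T + (-α * bumpScale k N M) • bump k N
        + (-1 * bumpScale k N M) • (T * bump k N))) x =
        (α + T x) * (1 - bumpScale k N M * bump k N x) := by
      simp only [Pi.add_apply, Pi.smul_apply, Pi.mul_apply, smul_eq_mul]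
      ring
    have h2 : 0 ≤ 1 - bumpScale k N M * bump k N x :=
      sub_nonneg.2 (bumpScale_mul_bump_le_one hk hN hM x)
    rw [e, abs_mul, abs_of_nonneg h2]
    linarith [le_bumpScale_mul_bump hk hM h0 h1, mul_le_mul_of_nonneg_right (hT x) h2]
  · have hz : (Δ_[1])^[k] (fun _ : ℤ => α) = 0 := by
      ext x
      exact fwdDiff_iter_eq_zero_of_const hk (c := α) fun _ _ _ => rfl
    rw [fwdDiff_iter_add, hz, zero_add, fwdDiff_iter_add, fwdDiff_iter_add]
    refine ((hΔ.add hb1).add hb2).mono ?_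
    have hα2 : (-α) ^ 2 ≤ 1 := by rw [neg_sq, sq_le_one_iff_abs_le_one]; exact hα
    have hlog : 0 ≤ Real.log N := Real.log_natCast_nonneg N
    set z := (1 + Real.log N) / (M : ℝ) ^ (2 * k - 1) with hz
    have hz0 : 0 ≤ z := by positivity
    have : (-α) ^ 2 * (2 * 4 ^ k * z) ≤ 1 * (2 * 4 ^ k * z) := by gcongr
    nlinarith

end TrendFilter

/-! ### Gluing the profiles along the knots. -/

namespace TrendFilter

open Finset fwdDiff

/-- Pointwise Cauchy–Schwarz over the nonvanishing terms only, so that the loss is the overlap K and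
not the number of pieces. -/
lemma SqSumLE.sum_of_overlap {ι : Type*} {s : Finset ι} {f : ι → ℤ → ℝ} {B : ι → ℝ} {K : ℕ}
    (hK : ∀ x, #{i ∈ s | f i x ≠ 0} ≤ K) (hf : ∀ i ∈ s, SqSumLE (f i) (B i)) :
    SqSumLE (∑ i ∈ s, f i) (K * ∑ i ∈ s, B i) := by
  intro r
  calc ∑ x ∈ r, (∑ i ∈ s, f i) x ^ 2 ≤ ∑ x ∈ r, K * ∑ i ∈ s, f i x ^ 2 := by
        refine sum_le_sum fun x _ => ?_
        rw [Finset.sum_apply, ← sum_filter_ne_zero]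
        refine (sq_sum_le_card_mul_sum_sq).trans ?_
        have h : ∑ i ∈ s with f i x ≠ 0, f i x ^ 2 ≤ ∑ i ∈ s, f i x ^ 2 :=
          sum_le_sum_of_subset_of_nonneg (filter_subset _ _) fun _ _ _ => sq_nonneg _
        have hc : (#{i ∈ s | f i x ≠ 0} : ℝ) ≤ K := by exact_mod_cast hK x
        gcongr
    _ = K * ∑ i ∈ s, ∑ x ∈ r, f i x ^ 2 := by rw [← mul_sum, sum_comm]
    _ ≤ K * ∑ i ∈ s, B i := by gcongr with i hi; exact hf i hi r

namespace IsKnots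

variable {k n s : ℕ} {t : ℕ → ℕ} (h : IsKnots k n s t)
include h

lemma lt {i j : ℕ} (hij : i < j) (hj : j ≤ s + 1) : t i < t j := by
  induction j, hij using Nat.le_induction with
  | base => exact h.strictMono i (by omega)
  | succ j _ ih => exact (ih (by omega)).trans (h.strictMono j (by omega))

lemma le {i j : ℕ} (hij : i ≤ j) (hj : j ≤ s + 1) : t i ≤ t j := by
  rcases hij.eq_or_lt with rfl | hij
  · exact le_rfl
  · exact (h.lt hij hj).le

lemma segLen_succ {i : ℕ} (hi : i ≤ s) : (segLen t (i + 1) : ℤ) = t (i + 1) - t i := by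
  have := h.strictMono i hi
  rw [segLen, Nat.add_sub_cancel]
  omega

lemma segLen_pos {i : ℕ} (hi : i ≤ s) : 0 < segLen t (i + 1) := by
  have := h.strictMono i hi
  rw [segLen, Nat.add_sub_cancel]
  omega

omit h in
lemma segLen_le_max {i : ℕ} (hi : i ≤ s) : segLen t (i + 1) ≤ maxSegLen s t :=
  le_sup (f := segLen t) (by simp; omega)

/-- At most `k` of the segments meet a window of length `k`. -/
lemma card_window_le (hk : 0 < k) (x : ℤ) :
    #{i ∈ range (s + 1) | (t i : ℤ) < x + k ∧ x < t (i + 1)} ≤ k := by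
  have := card_le_card_of_injOn (s := {i ∈ range (s + 1) | (t i : ℤ) < x + k ∧ x < t (i + 1)})
    (t := Ico x (x + k)) (fun i => max (t i : ℤ) x) ?_ ?_
  · simpa using this
  · intro i hi
    simp at hi ⊢
    omega
  · have key : ∀ i j, i < j → j ≤ s → x < t (i + 1) → max (t i : ℤ) x < max (t j : ℤ) x := by
      intro i j hij hj hx
      have h1 := h.le (show i + 1 ≤ j by omega) (by omega)
      have h2 := h.strictMono i (by omega)
      omega
    intro i hi j hj hij
    simp at hi hj hij
    by_contra hne
    rcases lt_or_gt_of_ne hne with hlt | hlt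
    · have := key i j hlt (by omega) (by omega)
      omega
    · have := key j i hlt (by omega) (by omega)
      omega

end IsKnots

lemma signChanges_subset (s : ℕ) (q : ℕ → ℝ) : signChanges s q ⊆ Icc 1 (s + 1) := by
  intro i hi
  simp only [signChanges, mem_union, mem_filter, mem_Icc, mem_insert, mem_singleton] at hi ⊢
  omega

/-- A vector interpolating the signs `q` at the knots, vanishing outside `{k+1, …, n}`. -/
lemma exists_interpolant (k : ℕ) (hk : 0 < k) : ∃ C δ : ℝ, 0 < C ∧ 0 < δ ∧
    ∀ (n s : ℕ) (t : ℕ → ℕ), IsKnots k n s t → ∀ q : ℕ → ℝ,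
    (∀ i ∈ Icc 1 s, q i = 1 ∨ q i = -1) → (∀ i ∈ signChanges s q, k ≤ segLen t i) →
    ∃ Q : ℤ → ℝ, (∀ x ≤ (k : ℤ), Q x = 0) ∧ (∀ x, (n : ℤ) < x → Q x = 0) ∧
      (∀ i ∈ Icc 1 s, Q (t i) = q i) ∧
      (∀ i ≤ s, ∀ x : ℤ, t i < x → x < t (i + 1) →
        |Q x| ≤ 1 - δ * √(((min (x - t i) (t (i + 1) - x) : ℤ) / maxSegLen s t : ℝ) ^ (2 * k - 1))) ∧
      SqSumLE ((Δ_[1])^[k] Q) (C * (∑ i ∈ signChanges s q,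
        (1 + Real.log (segLen t i)) / (segLen t i : ℝ) ^ (2 * k - 1)
        + ∑ i ∈ Icc 1 (s + 1) \ signChanges s q,
        (1 + Real.log (segLen t i)) / (maxSegLen s t : ℝ) ^ (2 * k - 1))) := by
  obtain ⟨C, δ, hC, hδ, H⟩ := exists_profile k hk
  refine ⟨k * C, δ, by positivity, hδ, ?_⟩
  intro n s t ht q hq hlen
  -- The value is 0 at the virtual knots t₀ and t_{s+1}, where Q must vanish. The first and last
  -- segments therefore need a transition (or both end values are 0), in accordance with 1 and s+1
  -- lying in S^±.
  set a : ℕ → ℝ := fun i => if 1 ≤ i ∧ i ≤ s then q i else 0 with ha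
  have ha1 : ∀ i, |a i| ≤ 1 := by
    intro i
    simp only [ha]
    split_ifs with hi
    · rcases hq i (mem_Icc.2 hi) with h | h <;> simp [h]
    · simp
  have ha0 : a 0 = 0 := by simp [ha]
  have has : a (s + 1) = 0 := by simp [ha]
  set M : ℕ → ℕ := fun i => if i ∈ signChanges s q then segLen t i else maxSegLen s t with hM
  have hNM : ∀ i ≤ s, segLen t (i + 1) ≤ M (i + 1) := by
    intro i hi
    simp only [hM]
    split_ifs
    · exact le_rfl
    · exact IsKnots.segLen_le_max hi
  have hMmax : ∀ i ≤ s, M (i + 1) ≤ maxSegLen s t := by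
    intro i hi
    simp only [hM]
    split_ifs
    · exact IsKnots.segLen_le_max hi
    · exact le_rfl
  have hcase : ∀ i ≤ s, a i = a (i + 1) ∨ M (i + 1) = segLen t (i + 1) ∧ k ≤ segLen t (i + 1) := by
    intro i hi
    by_cases hmem : i + 1 ∈ signChanges s q
    · exact Or.inr ⟨by simp [hM, hmem], hlen _ hmem⟩
    · left
      simp only [signChanges, mem_union, mem_filter, mem_Icc, mem_insert, mem_singleton,
        Nat.add_sub_cancel, not_or, not_and] at hmem
      have h1 : 1 ≤ i ∧ i + 1 ≤ s := by omega
      have h2 := hmem.1 (by omega)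
      simp only [ha]
      rw [if_pos (by omega), if_pos (by omega)]
      rcases hq i (mem_Icc.2 (by omega)) with h3 | h3 <;>
        rcases hq (i + 1) (mem_Icc.2 (by omega)) with h4 | h4 <;> simp [h3, h4] at h2 ⊢
  have hF : ∀ i, ∃ F : ℤ → ℝ, i ≤ s → (∀ x ≤ 0, F x = a i) ∧
      (∀ x, (segLen t (i + 1) : ℤ) ≤ x → F x = a (i + 1)) ∧
      (∀ x : ℤ, 0 < x → x < segLen t (i + 1) →
        |F x| ≤ 1 - δ * √(((min x (segLen t (i + 1) - x) : ℤ) / M (i + 1) : ℝ) ^ (2 * k - 1))) ∧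
      SqSumLE ((Δ_[1])^[k] F)
        (C * ((1 + Real.log (segLen t (i + 1))) / (M (i + 1) : ℝ) ^ (2 * k - 1))) := by
    intro i
    by_cases hi : i ≤ s
    · obtain ⟨F, hF⟩ := H (segLen t (i + 1)) (M (i + 1)) (a i) (a (i + 1)) (ht.segLen_pos hi)
        (hNM i hi) (ha1 i) (ha1 (i + 1)) (hcase i hi)
      exact ⟨F, fun _ => hF⟩
    · exact ⟨0, fun h => absurd h hi⟩
  choose F hF using hF
  have hleft : ∀ i ≤ s, ∀ x : ℤ, x ≤ t i → F i (x - t i) = a i := fun i hi x hx =>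
    (hF i hi).1 _ (by omega)
  have hright : ∀ i ≤ s, ∀ x : ℤ, t (i + 1) ≤ x → F i (x - t i) = a (i + 1) := fun i hi x hx =>
    (hF i hi).2.1 _ (by rw [ht.segLen_succ hi]; omega)
  -- `g i` is 0 left of its segment and `a (i + 1) - a i` right of it, so the sum telescopes to the
  -- local profile on each segment.
  set g : ℕ → ℤ → ℝ := fun i x => F i (x - t i) - a i with hg
  have hQ : ∀ i ≤ s, ∀ x : ℤ, t i ≤ x → x ≤ t (i + 1) →
      (∑ j ∈ range (s + 1), g j) x = F i (x - t i) := by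
    intro i hi x h1 h2
    rw [Finset.sum_apply]
    have e1 : ∑ j ∈ range (i + 1), g j x = ∑ j ∈ range (s + 1), g j x := by
      refine sum_subset (range_subset_range.2 (by omega)) fun j hj hj' => ?_
      rw [mem_range] at hj hj'
      have := ht.le (show i + 1 ≤ j by omega) (by omega)
      simp only [hg]
      rw [hleft j (by omega) x (by omega), sub_self]
    have e2 : ∑ j ∈ range i, g j x = ∑ j ∈ range i, (a (j + 1) - a j) := by
      refine sum_congr rfl fun j hj => ?_
      rw [mem_range] at hj
      have := ht.le (show j + 1 ≤ i by omega) (by omega)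
      simp only [hg]
      rw [hright j (by omega) x (by omega)]
    rw [← e1, sum_range_succ, e2, sum_range_sub, ha0]
    simp [hg]
  refine ⟨∑ j ∈ range (s + 1), g j, ?_, ?_, ?_, ?_, ?_⟩
  · intro x hx
    rw [Finset.sum_apply]
    refine sum_eq_zero fun j hj => ?_
    rw [mem_range] at hj
    have h1 := ht.le (Nat.zero_le j) (by omega)
    rw [ht.left] at h1
    simp only [hg]
    rw [hleft j (by omega) x (by omega), sub_self]
  · intro x hx
    rw [Finset.sum_apply, ← sub_zero (0 : ℝ)]
    nth_rewrite 1 [← has]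
    rw [← ha0, ← sum_range_sub]
    refine sum_congr rfl fun j hj => ?_
    rw [mem_range] at hj
    have h1 := ht.le (show j + 1 ≤ s + 1 by omega) le_rfl
    rw [ht.right] at h1
    simp only [hg]
    rw [hright j (by omega) x (by omega)]
  · intro i hi
    rw [mem_Icc] at hi
    have := ht.strictMono i hi.2
    rw [hQ i hi.2 _ le_rfl (by omega), hleft i hi.2 _ le_rfl]
    simp [ha, hi]
  · intro i hi x h1 h2
    rw [hQ i hi x h1.le h2.le]
    have h := (hF i hi).2.2.1 (x - t i) (by omega) (by rw [ht.segLen_succ hi]; omega)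
    rw [ht.segLen_succ hi, show (t (i + 1) : ℤ) - t i - (x - t i) = t (i + 1) - x by ring] at h
    refine h.trans ?_
    have hM0 : (0 : ℝ) < M (i + 1) := by exact_mod_cast (ht.segLen_pos hi).trans_le (hNM i hi)
    have hMm : (M (i + 1) : ℝ) ≤ maxSegLen s t := by exact_mod_cast hMmax i hi
    have hm0 : (0 : ℝ) ≤ (min (x - t i) (t (i + 1) - x) : ℤ) := by
      exact_mod_cast (by omega : 0 ≤ min (x - t i) (t (i + 1) - x))
    gcongr
  · have hz : ∀ i, (Δ_[1])^[k] (g i) = fun x => (Δ_[1])^[k] (F i) (x + -(t i : ℤ)) := by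
      intro i
      have e : g i = (fun x => F i (x + -(t i : ℤ))) + (fun _ => -a i) := by
        ext x; simp [hg, sub_eq_add_neg]
      have hz : (Δ_[1])^[k] (fun _ : ℤ => -a i) = 0 := by
        ext x
        exact fwdDiff_iter_eq_zero_of_const hk (c := -a i) fun _ _ _ => rfl
      rw [e, fwdDiff_iter_add, hz, add_zero]
      ext x
      rw [fwdDiff_iter_comp_add]
    rw [fwdDiff_iter_finsetSum]
    have h := SqSumLE.sum_of_overlap (s := range (s + 1)) (f := fun i => (Δ_[1])^[k] (g i))
      (B := fun i => C * ((1 + Real.log (segLen t (i + 1))) / (M (i + 1) : ℝ) ^ (2 * k - 1)))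
      (K := k) ?_ ?_
    · refine h.mono (le_of_eq ?_)
      rw [← mul_sum, ← mul_assoc]
      congr 1
      rw [range_eq_Ico, sum_Ico_add' (fun i => (1 + Real.log (segLen t i)) / (M i : ℝ) ^ (2 * k - 1)),
        zero_add, show Ico 1 (s + 1 + 1) = Icc 1 (s + 1) by ext; simp,
        ← sum_sdiff (signChanges_subset s q), add_comm]
      congr 1
      · exact sum_congr rfl fun i hi => by simp [hM, hi]
      · refine sum_congr rfl fun i hi => ?_
        rw [mem_sdiff] at hi
        simp [hM, hi.2]
    · intro x
      -- The k-th difference at x sees only {x, …, x+k}, where `g i` is constant unless the window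
      -- meets its segment.
      refine (card_le_card ?_).trans (ht.card_window_le hk x)
      intro i hi
      rw [mem_filter, mem_range] at hi ⊢
      refine ⟨hi.1, ?_⟩
      by_contra hcon
      refine hi.2 ?_
      rw [not_and_or, not_lt, not_lt] at hcon
      rcases hcon with hcon | hcon
      · refine fwdDiff_iter_eq_zero_of_const hk (c := 0) fun y _ hy => ?_
        simp only [hg]
        rw [hleft i (by omega) y (by omega), sub_self]
      · refine fwdDiff_iter_eq_zero_of_const hk (c := a (i + 1) - a i) fun y hy _ => ?_
        simp only [hg]
        rw [hright i (by omega) y (by omega)]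
    · intro i hi
      rw [mem_range] at hi
      simp only [hz]
      exact (hF i (by omega)).2.2.2.comp_add _

end TrendFilter

/-! ### Summation by parts, interior rows and their dual vectors. -/

namespace TrendFilter

open Finset fwdDiff

lemma fwdDiff_iter_eq_sum_backward (k : ℕ) (φ : ℤ → ℝ) (y : ℤ) :
    (Δ_[1])^[k] φ y = ∑ l ∈ range (k + 1), (-1 : ℝ) ^ l * (k.choose l : ℝ) * φ (y + k - l) := by
  rw [fwdDiff_iter_eq_sum_shift, ← sum_range_reflect]
  refine sum_congr rfl fun l hl => ?_
  rw [mem_range] at hl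
  rw [show k + 1 - 1 - l = k - l by omega, show k - (k - l) = l by omega,
    Nat.choose_symm (by omega)]
  rw [zsmul_eq_mul]
  have e : y + (k - l : ℕ) • (1 : ℤ) = y + k - l := by
    rw [nsmul_one, Nat.cast_sub (by omega)]
    ring
  rw [e]
  push_cast
  ring

lemma neg_one_pow_mul_fwdDiff_iter (k : ℕ) (φ : ℤ → ℝ) (y : ℤ) :
    (-1) ^ k * (Δ_[1])^[k] φ y =
      ∑ l ∈ range (k + 1), (-1 : ℝ) ^ l * (k.choose l : ℝ) * φ (y + l) := by
  rw [fwdDiff_iter_eq_sum_shift, mul_sum]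
  refine sum_congr rfl fun l hl => ?_
  rw [mem_range] at hl
  rw [zsmul_eq_mul]
  push_cast
  have : (-1 : ℝ) ^ k * (-1) ^ (k - l) = (-1) ^ l := by
    obtain ⟨m, rfl⟩ : ∃ m, k = l + m := ⟨k - l, by omega⟩
    rw [Nat.add_sub_cancel_left, pow_add, mul_assoc, ← pow_add, ← two_mul, pow_mul]
    simp
  rw [← this]
  simp
  ring

/-- The restriction to `{1, …, n}` of a sequence. -/
def restrict (n : ℕ) (φ : ℤ → ℝ) : Vec n := fun x => φ (x : ℕ)

lemma diff_restrict (k : ℕ) {n : ℕ} (φ : ℤ → ℝ) (j : Icc (k + 1) n) :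
    diff k (restrict n φ) j = (Δ_[1])^[k] φ ((j : ℕ) - k) := by
  obtain ⟨j, hj⟩ := j
  rw [mem_Icc] at hj
  rw [fwdDiff_iter_eq_sum_backward]
  simp only [diff, Matrix.mulVec, dotProduct, diffMatrix, restrict]
  rw [sum_coe_sort (Icc 1 n) (fun x : ℕ => (if x ≤ j ∧ j - x ≤ k then
    (-1 : ℝ) ^ (j - x) * (k.choose (j - x) : ℝ) else 0) * φ x)]
  simp only [ite_mul, zero_mul]
  rw [← sum_filter]
  refine sum_bij' (fun x _ => j - x) (fun l _ => j - l) ?_ ?_ ?_ ?_ ?_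
  · intro x hx; simp at hx ⊢; omega
  · intro l hl; simp at hl ⊢; omega
  · intro x hx; simp at hx ⊢; omega
  · intro l hl; simp at hl ⊢; omega
  · intro x hx
    simp at hx
    congr 2
    push_cast [hx.2.1]
    ring

/-- Summation by parts; there are no boundary terms because Q vanishes outside {k+1, …, n}. -/
lemma sum_mul_diff (k : ℕ) {n : ℕ} {Q : ℤ → ℝ} (h0 : ∀ x ≤ (k : ℤ), Q x = 0)
    (h1 : ∀ x, (n : ℤ) < x → Q x = 0) (h : Vec n) :
    ∑ j : Icc (k + 1) n, Q (j : ℕ) * diff k h j =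
      ∑ x : Icc 1 n, (-1) ^ k * (Δ_[1])^[k] Q (x : ℕ) * h x := by
  simp only [diff, Matrix.mulVec, dotProduct, mul_sum]
  rw [sum_comm]
  refine sum_congr rfl fun x _ => ?_
  simp only [← mul_assoc]
  rw [← sum_mul]
  congr 1
  obtain ⟨x, hx⟩ := x
  rw [mem_Icc] at hx
  rw [neg_one_pow_mul_fwdDiff_iter]
  simp only [diffMatrix]
  rw [sum_coe_sort (Icc (k + 1) n) (fun j : ℕ => Q j * (if x ≤ j ∧ j - x ≤ k then
    (-1 : ℝ) ^ (j - x) * (k.choose (j - x) : ℝ) else 0))]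
  simp only [mul_ite, mul_zero]
  rw [← sum_filter]
  have e : ∑ l ∈ range (k + 1), (-1 : ℝ) ^ l * (k.choose l : ℝ) * Q (x + l) =
      ∑ j ∈ Icc x (x + k), Q j * ((-1 : ℝ) ^ (j - x) * (k.choose (j - x) : ℝ)) := by
    refine sum_bij' (fun l _ => x + l) (fun j _ => j - x) ?_ ?_ ?_ ?_ ?_
    · intro l hl; simp at hl ⊢; omega
    · intro j hj; simp at hj ⊢; omega
    · intro l hl; simp
    · intro j hj; simp at hj ⊢; omega
    · intro l hl
      simp
      ring
  rw [e]
  refine sum_subset ?_ ?_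
  · intro j hj; simp at hj ⊢; omega
  · intro j hj hj'
    simp at hj hj'
    rcases le_or_gt j k with h | h
    · rw [h0 j (by omega), zero_mul]
    · rw [h1 j (by omega), zero_mul]

/-- The unit mass at `1`. -/
noncomputable def unitMass (d : ℤ) : ℝ := if d = 1 then 1 else 0

lemma unitMass_of_nonpos (d : ℤ) (hd : d ≤ 0) : unitMass d = 0 := if_neg (by omega)

lemma iterSum_unitMass_nonneg (m : ℕ) (d : ℤ) : 0 ≤ iterSum unitMass m d :=
  iterSum_nonneg (fun d => by rw [unitMass]; split_ifs <;> simp) m d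

/-- `iterSum unitMass k` is a fundamental solution of the k-th difference and grows like a power of
degree k - 1; this crude bound suffices for dual vectors. -/
lemma iterSum_unitMass_le (m : ℕ) {d : ℤ} (hd : 0 < d) :
    iterSum unitMass (m + 1) d ≤ (d : ℝ) ^ m := by
  induction m generalizing d with
  | zero => simp [iterSum, unitMass]; split_ifs <;> norm_num
  | succ m ih =>
    rw [iterSum]
    have h1 : (0 : ℝ) ≤ d := by exact_mod_cast hd.le
    calc ∑ j ∈ Icc 1 d, iterSum unitMass (m + 1) j ≤ ∑ j ∈ Icc 1 d, (d : ℝ) ^ m := by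
          refine sum_le_sum fun j hj => ?_
          rw [mem_Icc] at hj
          have hj0 : (0 : ℝ) ≤ j := by exact_mod_cast (by omega : 0 ≤ j)
          have hjd : (j : ℝ) ≤ d := by exact_mod_cast hj.2
          refine (ih (by omega)).trans ?_
          gcongr
      _ = (d : ℝ) ^ (m + 1) := by
          have : (d.toNat : ℝ) = d := by exact_mod_cast Int.toNat_of_nonneg hd.le
          simp [Int.card_Icc, this]
          ring

lemma sq_iterSum_unitMass_le {k : ℕ} (hk : 0 < k) {d e : ℤ} (hde : d ≤ e) (he : 0 ≤ e) :
    iterSum unitMass k d ^ 2 ≤ (e : ℝ) ^ (2 * k - 2) := by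
  have he' : (0 : ℝ) ≤ e := by exact_mod_cast he
  rcases le_or_gt d 0 with hd | hd
  · rw [iterSum_of_nonpos unitMass_of_nonpos k hd, zero_pow two_ne_zero]
    positivity
  · obtain ⟨m, rfl⟩ : ∃ m, k = m + 1 := ⟨k - 1, by omega⟩
    have hd' : (0 : ℝ) ≤ d := by exact_mod_cast hd.le
    have hde' : (d : ℝ) ≤ e := by exact_mod_cast hde
    calc iterSum unitMass (m + 1) d ^ 2 ≤ ((d : ℝ) ^ m) ^ 2 := by
          gcongr
          · exact iterSum_unitMass_nonneg _ _
          · exact iterSum_unitMass_le m hd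
      _ ≤ ((e : ℝ) ^ m) ^ 2 := by gcongr
      _ = _ := by rw [← pow_mul]; congr 1; omega

lemma fwdDiff_iter_congr {k : ℕ} {f g : ℤ → ℝ} {x : ℤ}
    (h : ∀ y, x ≤ y → y ≤ x + k → f y = g y) : (Δ_[1])^[k] f x = (Δ_[1])^[k] g x := by
  rw [fwdDiff_iter_eq_sum_shift, fwdDiff_iter_eq_sum_shift]
  refine sum_congr rfl fun i hi => ?_
  rw [mem_range] at hi
  rw [h] <;> simp; omega

open Classical in
/-- The rows of `Δ(k)` whose stencil is not separated by a knot. -/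
noncomputable def interior (k n s : ℕ) (t : ℕ → ℕ) : Finset (Icc (k + 1) n) :=
  {j | ∀ i ∈ Icc 1 s, (j : ℕ) < t i ∨ t i + k ≤ j}

/-- Each knot spoils at most k of the n - k rows. This is what bounds the kernel dimension by
k(s+1). -/
lemma card_interior_ge (k n s : ℕ) (t : ℕ → ℕ) : n ≤ #(interior k n s t) + k * (s + 1) := by
  have h1 : #(univ : Finset (Icc (k + 1) n)) = n - k := by simp
  have h2 : #(interior k n s t)ᶜ ≤ s * k := by
    have := card_le_card_of_injOn (s := (interior k n s t)ᶜ)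
      (t := (Icc 1 s).biUnion fun i => Ico (t i) (t i + k)) (fun j => (j : ℕ)) ?_ ?_
    · refine this.trans (card_biUnion_le.trans ?_)
      simp
    · intro j hj
      simp [interior] at hj
      obtain ⟨i, h1, h2, h3, h4⟩ := hj
      simp
      exact ⟨i, by omega⟩
    · intro a _ b _ h
      exact Subtype.ext h
  have h3 := card_add_card_compl (interior k n s t)
  rw [Fintype.card_coe, Nat.card_Icc] at h3
  have : s * k + k = k * (s + 1) := by ring
  omega

lemma exists_segment {k n s : ℕ} {t : ℕ → ℕ} (ht : IsKnots k n s t) (j : Icc (k + 1) n)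
    (hj : (j : ℕ) ∉ activeSet s t) : ∃ i ≤ s, t i < j ∧ j < t (i + 1) := by
  simp only [activeSet, mem_image, mem_Icc, not_exists, not_and] at hj
  have hj2 := mem_Icc.1 j.2
  have key : ∀ m ≤ s + 1, (j : ℕ) < t m → ∃ i < m, t i < j ∧ j < t (i + 1) := by
    intro m
    induction m with
    | zero => intro _ h; rw [ht.left] at h; omega
    | succ m ih =>
      intro hm h
      rcases lt_trichotomy (t m) j with h' | h' | h'
      · exact ⟨m, by omega, h', h⟩
      · exfalso
        rcases Nat.eq_zero_or_pos m with rfl | h0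
        · rw [ht.left] at h'; omega
        · exact hj m ⟨h0, by omega⟩ h'
      · obtain ⟨i, hi, hi'⟩ := ih (by omega) h'
        exact ⟨i, by omega, hi'⟩
  obtain ⟨i, hi, h⟩ := key (s + 1) le_rfl (by rw [ht.right]; omega)
  exact ⟨i, by omega, h⟩

lemma notMem_activeSet_of_mem_interior {k n s : ℕ} {t : ℕ → ℕ} (hk : 0 < k) {j : Icc (k + 1) n}
    (hj : j ∈ interior k n s t) : (j : ℕ) ∉ activeSet s t := by
  simp only [interior, mem_filter, mem_univ, true_and] at hj
  simp only [activeSet, mem_image, not_exists, not_and]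
  intro i hi h
  have := hj i hi
  omega

lemma IsKnots.card_activeSet {k n s : ℕ} {t : ℕ → ℕ} (ht : IsKnots k n s t) :
    #(activeSet s t) = s := by
  rw [activeSet, card_image_of_injOn, Nat.card_Icc, Nat.add_sub_cancel]
  intro i hi j hj hij
  simp only [coe_Icc, Set.mem_Icc] at hi hj
  by_contra hne
  rcases lt_or_gt_of_ne hne with h | h
  · have := ht.lt h (by omega)
    omega
  · have := ht.lt h (by omega)
    omega

/-- Knots are not interior, so at most n-k-s directions enter the union bound: the count inside λ₀.
-/
lemma card_interior_add_le {k n s : ℕ} {t : ℕ → ℕ} (hk : 0 < k) (ht : IsKnots k n s t) :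
    #(interior k n s t) + s ≤ n - k := by
  have h1 : Disjoint ((interior k n s t).map (Function.Embedding.subtype _)) (activeSet s t) := by
    rw [disjoint_left]
    intro j hj
    obtain ⟨j, hj', rfl⟩ := mem_map.1 hj
    exact notMem_activeSet_of_mem_interior hk hj'
  have h2 : (interior k n s t).map (Function.Embedding.subtype _) ∪ activeSet s t ⊆
      Icc (k + 1) n := by
    refine union_subset (fun j hj => ?_) fun j hj => ?_
    · obtain ⟨j, hj, rfl⟩ := mem_map.1 hj
      exact j.2
    · simp only [activeSet, mem_image, mem_Icc] at hj
      obtain ⟨i, hi, rfl⟩ := hj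
      have h3 := ht.lt (show 0 < i by omega) (by omega)
      have h4 := ht.lt (show i < s + 1 by omega) le_rfl
      rw [ht.left] at h3
      rw [ht.right] at h4
      simp
      omega
  have h3 := card_le_card h2
  rw [card_union_of_disjoint h1, card_map, ht.card_activeSet, Nat.card_Icc] at h3
  omega

lemma sum_sq_restrict_le {n : ℕ} {φ : ℤ → ℝ} {s : Finset ℤ} {K : ℝ} (hφ : ∀ x ∈ s, φ x ^ 2 ≤ K)
    (hs : ∀ x : ℤ, 1 ≤ x → x ∉ s → φ x = 0) : ∑ x, restrict n φ x ^ 2 ≤ #s * K := by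
  simp only [restrict]
  rw [sum_coe_sort (Icc 1 n) (fun x : ℕ => φ x ^ 2)]
  calc ∑ x ∈ Icc 1 n, φ (x : ℕ) ^ 2 = ∑ x ∈ (Icc 1 n).map Nat.castEmbedding, φ x ^ 2 := by simp
    _ ≤ ∑ x ∈ (Icc 1 n).map Nat.castEmbedding with x ∈ s, φ x ^ 2 := by
        refine le_of_eq (sum_filter_of_ne fun x hx h => ?_).symm
        by_contra hxs
        simp at hx
        refine h ?_
        rw [hs x (by omega) hxs]
        simp
    _ ≤ ∑ x ∈ s, φ x ^ 2 :=
        sum_le_sum_of_subset_of_nonneg (fun x hx => (mem_filter.1 hx).2) fun _ _ _ => sq_nonneg _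
    _ ≤ #s • K := sum_le_card_nsmul _ _ _ hφ
    _ = #s * K := by simp

variable {k n s : ℕ} {t : ℕ → ℕ}

/-- Take the fundamental solution started at j and cut it off at the next knot b. An interior
stencil lies entirely before b or entirely from b on, so the cut is invisible to it. At most b - j
entries survive, each of size at most (b-j)^(k-1). -/
lemma exists_dual_right (hk : 0 < k) (ht : IsKnots k n s t) (j : Icc (k + 1) n) {i : ℕ}
    (hi : i ≤ s) (hj : (j : ℕ) < t (i + 1)) :
    ∃ χ : Vec n, (∀ j' ∈ interior k n s t, diff k χ j' = if j' = j then 1 else 0) ∧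
      ∑ x, χ x ^ 2 ≤ ((t (i + 1) - (j : ℕ) : ℤ) : ℝ) ^ (2 * k - 1) := by
  set b := t (i + 1) with hb
  set φ : ℤ → ℝ := fun x => if x < b then iterSum unitMass k (x - (j : ℕ) + 1) else 0 with hφ
  refine ⟨restrict n φ, ?_, ?_⟩
  · intro j' hj'
    rw [diff_restrict]
    have hj2 := mem_Icc.1 j'.2
    have hcase : (j' : ℕ) < b ∨ b + k ≤ j' := by
      rcases eq_or_lt_of_le hi with rfl | h
      · left; rw [hb, ht.right]; omega
      · simp only [interior, mem_filter, mem_univ, true_and, mem_Icc] at hj'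
        exact hj' (i + 1) (by omega)
    rcases hcase with h | h
    · have e : (Δ_[1])^[k] φ ((j' : ℕ) - k) =
          (Δ_[1])^[k] (fun x => iterSum unitMass (0 + k) (x + (1 - (j : ℕ)))) ((j' : ℕ) - k) := by
        refine fwdDiff_iter_congr fun y _ hy => ?_
        simp only [hφ]
        rw [if_pos (by omega)]
        simp; ring_nf
      rw [e, fwdDiff_iter_comp_add, fwdDiff_iter_iterSum unitMass_of_nonpos]
      simp only [iterSum, unitMass]
      refine if_congr ?_ rfl rfl
      rw [Subtype.ext_iff]
      omega
    · rw [if_neg (by rw [Subtype.ext_iff]; omega)]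
      refine fwdDiff_iter_eq_zero_of_const hk (c := 0) fun y hy _ => ?_
      simp only [hφ]
      rw [if_neg (by omega)]
  · have h := sum_sq_restrict_le (n := n) (φ := φ) (s := Ico ((j : ℕ) : ℤ) b)
      (K := ((b - (j : ℕ) : ℤ) : ℝ) ^ (2 * k - 2)) ?_ ?_
    · refine h.trans (le_of_eq ?_)
      have : ((#(Ico ((j : ℕ) : ℤ) b) : ℕ) : ℝ) = ((b - (j : ℕ) : ℤ) : ℝ) := by
        rw [Int.card_Ico, ← Int.cast_natCast, Int.toNat_of_nonneg (by omega)]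
      rw [this, ← pow_succ']
      congr 1
      omega
    · intro x hx
      rw [mem_Ico] at hx
      simp only [hφ]
      rw [if_pos hx.2]
      exact sq_iterSum_unitMass_le hk (by omega) (by omega)
    · intro x _ hx
      rw [mem_Ico, not_and] at hx
      simp only [hφ]
      split_ifs with h
      · exact iterSum_of_nonpos unitMass_of_nonpos k (by omega)
      · rfl

/-- The mirror image: the fundamental solution grows leftwards from j - k and is cut off at the
preceding knot; `(-1) ^ k` compensates the reflection. -/
lemma exists_dual_left (hk : 0 < k) (ht : IsKnots k n s t) (j : Icc (k + 1) n) {i : ℕ}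
    (hi : i ≤ s) (hj : t i < (j : ℕ)) (hj' : 1 ≤ i → t i + k ≤ j) :
    ∃ χ : Vec n, (∀ j' ∈ interior k n s t, diff k χ j' = if j' = j then 1 else 0) ∧
      ∑ x, χ x ^ 2 ≤ (((j : ℕ) - t i : ℤ) : ℝ) ^ (2 * k - 1) := by
  -- `a` is the cut. In the first segment it is 1, the start of the signal, because t₀ = k is not a
  -- true knot.
  obtain ⟨a, ha1, ha2, ha⟩ : ∃ a : ℕ, t i + 1 ≤ a + k ∧ (a + k ≤ j) ∧
      ∀ j' ∈ interior k n s t, (j' : ℕ) < a ∨ a + k ≤ j' := by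
    rcases Nat.eq_zero_or_pos i with rfl | h
    · rw [ht.left] at *
      refine ⟨1, by omega, by omega, fun j' _ => ?_⟩
      have := mem_Icc.1 j'.2
      omega
    · refine ⟨t i, by omega, hj' h, fun j' hj' => ?_⟩
      simp only [interior, mem_filter, mem_univ, true_and, mem_Icc] at hj'
      exact hj' i (by omega)
  set φ : ℤ → ℝ := fun x =>
    if a ≤ x then (-1) ^ k * iterSum unitMass k (((j : ℕ) - k + 1 : ℤ) - x) else 0 with hφ
  refine ⟨restrict n φ, ?_, ?_⟩
  · intro j' hj'
    rw [diff_restrict]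
    rcases ha j' hj' with h | h
    · rw [if_neg (by rw [Subtype.ext_iff]; omega)]
      refine fwdDiff_iter_eq_zero_of_const hk (c := 0) fun y _ hy => ?_
      simp only [hφ]
      rw [if_neg (by omega)]
    · have e : (Δ_[1])^[k] φ ((j' : ℕ) - k) =
          (Δ_[1])^[k] (((-1 : ℝ) ^ k) • fun x => iterSum unitMass (0 + k) (((j : ℕ) - k + 1 : ℤ) - x))
            ((j' : ℕ) - k) := by
        refine fwdDiff_iter_congr fun y hy _ => ?_
        simp only [hφ]
        rw [if_pos (by omega)]
        simp
      rw [e, fwdDiff_iter_const_smul, fwdDiff_iter_iterSum_sub unitMass_of_nonpos]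
      simp only [iterSum, unitMass, Pi.smul_apply, smul_eq_mul]
      rw [← mul_assoc, ← mul_pow, neg_one_mul, neg_neg, one_pow, one_mul]
      refine if_congr ?_ rfl rfl
      rw [Subtype.ext_iff]
      omega
  · have h := sum_sq_restrict_le (n := n) (φ := φ) (s := Icc (a : ℤ) ((j : ℕ) - k))
      (K := (((j : ℕ) - t i : ℤ) : ℝ) ^ (2 * k - 2)) ?_ ?_
    · refine h.trans ?_
      have h0 : (0 : ℝ) ≤ (((j : ℕ) - t i : ℤ) : ℝ) := Int.cast_nonneg (by omega)
      have : ((#(Icc (a : ℤ) ((j : ℕ) - k)) : ℕ) : ℝ) ≤ (((j : ℕ) - t i : ℤ) : ℝ) := by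
        rw [Int.card_Icc, ← Int.cast_natCast, Int.cast_le]
        omega
      calc _ ≤ (((j : ℕ) - t i : ℤ) : ℝ) * (((j : ℕ) - t i : ℤ) : ℝ) ^ (2 * k - 2) := by gcongr
        _ = _ := by
          rw [← pow_succ']
          congr 1
          omega
    · intro x hx
      rw [mem_Icc] at hx
      simp only [hφ]
      rw [if_pos hx.1, mul_pow, ← pow_mul, mul_comm k 2, pow_mul, neg_one_sq, one_pow, one_mul]
      exact sq_iterSum_unitMass_le hk (by omega) (by omega)
    · intro x _ hx
      rw [mem_Icc, not_and] at hx
      simp only [hφ]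
      split_ifs with h
      · rw [iterSum_of_nonpos unitMass_of_nonpos k (by have := hx h; omega), mul_zero]
      · rfl

end TrendFilter

/-! ### Projection onto a kernel, and Gaussian tails. -/

namespace TrendFilter

open Module
open scoped RealInnerProductSpace

section LinearAlgebra

variable {E κ : Type*} [NormedAddCommGroup E] [InnerProductSpace ℝ E] [FiniteDimensional ℝ E]
  [Fintype κ] [DecidableEq κ]

lemma finrank_ker_add_card (L : E →ₗ[ℝ] (κ → ℝ)) (hL : ∀ j, ∃ χ, L χ = Pi.single j 1) :
    finrank ℝ (LinearMap.ker L) + Fintype.card κ = finrank ℝ E := by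
  have hsurj : LinearMap.range L = ⊤ := by
    rw [eq_top_iff, ← (Pi.basisFun ℝ κ).span_eq, Submodule.span_le]
    rintro _ ⟨j, rfl⟩
    obtain ⟨χ, hχ⟩ := hL j
    exact ⟨χ, by simp [hχ]⟩
  have := L.finrank_range_add_finrank_ker
  rw [hsurj, finrank_top, finrank_fintype_fun_eq_card] at this
  omega

/-- The projection onto the complement of `ker L`, in terms of the coordinates of `L`. -/
lemma exists_dual_decomposition (L : E →ₗ[ℝ] (κ → ℝ)) (hL : ∀ j, ∃ χ, L χ = Pi.single j 1) :
    ∃ ψ : κ → E, (∀ h, h = (LinearMap.ker L).starProjection h + ∑ j, L h j • ψ j) ∧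
      ∀ j χ, L χ = Pi.single j 1 → ‖ψ j‖ ≤ ‖χ‖ := by
  choose χ hχ using hL
  set P := (LinearMap.ker L).starProjection with hP
  have hPker : ∀ x ∈ LinearMap.ker L, P x = x := fun x hx =>
    Submodule.starProjection_eq_self_iff.2 hx
  -- Two dual vectors for j differ by a kernel element, so this residual does not depend on the
  -- choice; being an orthogonal projection of each, it is no longer than any of them.
  refine ⟨fun j => χ j - P (χ j), fun h => ?_, fun j χ' hχ' => ?_⟩
  · have hmem : h - ∑ j, L h j • χ j ∈ LinearMap.ker L := by
      rw [LinearMap.mem_ker, map_sub, map_sum, sub_eq_zero]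
      ext i
      simp [hχ, Finset.sum_apply, Pi.single_apply]
    have := hPker _ hmem
    rw [map_sub, map_sum] at this
    simp only [smul_sub, Finset.sum_sub_distrib]
    simp only [map_smul] at this
    rw [sub_eq_sub_iff_add_eq_add] at this
    rw [← add_sub_assoc, this, add_sub_cancel_right]
  · have hmem : χ j - χ' ∈ LinearMap.ker L := by
      rw [LinearMap.mem_ker, map_sub, hχ, hχ', sub_self]
    have h1 := hPker _ hmem
    rw [map_sub] at h1
    have h2 : χ j - P (χ j) = χ' - P χ' := by
      rw [sub_eq_sub_iff_add_eq_add] at h1 ⊢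
      rw [add_comm χ', ← h1, add_comm]
    have h3 : χ' - P χ' = (LinearMap.ker L)ᗮ.starProjection χ' := by
      rw [Submodule.starProjection_orthogonal_val]
    simp only
    rw [h2, h3]
    exact Submodule.norm_starProjection_apply_le _ _

end LinearAlgebra

section Gaussian

variable {E : Type*} [NormedAddCommGroup E] [InnerProductSpace ℝ E] [FiniteDimensional ℝ E]
  [MeasurableSpace E] [BorelSpace E]

lemma stdGaussian_map_orthogonalProjectionOnto (V : Submodule ℝ E) :
    (stdGaussian E).map V.orthogonalProjectionOnto = stdGaussian V := by
  have : IsProbabilityMeasure ((stdGaussian E).map V.orthogonalProjectionOnto) :=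
    Measure.isProbabilityMeasure_map (by fun_prop)
  apply Measure.ext_of_charFun
  ext t
  rw [charFun_stdGaussian, charFun_apply, integral_map (by fun_prop) (by fun_prop)]
  have : ∀ x : E, ⟪V.orthogonalProjectionOnto x, t⟫ = ⟪x, (t : E)⟫ := fun x => by
    rw [Submodule.inner_orthogonalProjectionOnto_eq_of_mem_right]
  simp only [this]
  rw [← charFun_apply, charFun_stdGaussian]
  rfl

lemma integral_exp_mul_sq_gaussianReal {θ : ℝ} (hθ : θ < 1 / 2) :
    ∫ x, Real.exp (θ * x ^ 2) ∂(gaussianReal 0 1) = (√(1 - 2 * θ))⁻¹ := by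
  rw [integral_gaussianReal_eq_integral_smul one_ne_zero]
  have e : ∀ x : ℝ, gaussianPDFReal 0 1 x • Real.exp (θ * x ^ 2) =
      (√(2 * Real.pi))⁻¹ * Real.exp (-(1 / 2 - θ) * x ^ 2) := by
    intro x
    rw [gaussianPDFReal, smul_eq_mul, mul_assoc, ← Real.exp_add, NNReal.coe_one]
    ring_nf
  simp only [e]
  rw [integral_const_mul, integral_gaussian, ← Real.sqrt_inv, ← Real.sqrt_inv, ← Real.sqrt_mul (by positivity)]
  congr 1
  have : 1 / 2 - θ ≠ 0 := by linarith
  have : 1 - 2 * θ ≠ 0 := by linarith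
  field_simp

lemma mgf_sq_norm_stdGaussian {θ : ℝ} (hθ : θ < 1 / 2) :
    mgf (fun x : E => ‖x‖ ^ 2) (stdGaussian E) θ = (√(1 - 2 * θ))⁻¹ ^ finrank ℝ E := by
  rw [mgf, stdGaussian, integral_map (Measurable.aemeasurable (by fun_prop)) (by fun_prop)]
  have e : ∀ x : Fin (finrank ℝ E) → ℝ,
      Real.exp (θ * ‖∑ i, x i • stdOrthonormalBasis ℝ E i‖ ^ 2) = ∏ i, Real.exp (θ * x i ^ 2) := by
    intro x
    rw [← Real.exp_sum, ← Finset.mul_sum, ← (stdOrthonormalBasis ℝ E).sum_sq_norm_inner_right]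
    congr 2
    refine Finset.sum_congr rfl fun i _ => ?_
    rw [Orthonormal.inner_right_fintype (stdOrthonormalBasis ℝ E).orthonormal]
    simp
  simp only [e]
  rw [integral_fintype_prod_eq_prod (f := fun _ x => Real.exp (θ * x ^ 2))]
  simp [integral_exp_mul_sq_gaussianReal hθ]

lemma measureReal_norm_stdGaussian_le {d : ℕ} (hd : 0 < d) (hE : finrank ℝ E ≤ d) {v : ℝ}
    (hv : 0 < v) : (stdGaussian E).real {x | √d + √(2 * v) ≤ ‖x‖} ≤ Real.exp (-v) := by
  have ha : 0 < √(d : ℝ) := Real.sqrt_pos.2 (by exact_mod_cast hd)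
  have hb : 0 < √(2 * v) := by positivity
  have hd' := Real.sq_sqrt (Nat.cast_nonneg (α := ℝ) d)
  have hv' := Real.sq_sqrt (show 0 ≤ 2 * v by positivity)
  set a := √(d : ℝ)
  set b := √(2 * v)
  -- With this θ the Chernoff exponent is -b(a+b)/2 + (d/2) log(1 + b/a) in dimension d = a², and
  -- log(1 + x) ≤ x brings it down to -b²/2 = -v.
  set θ := b / (2 * (a + b)) with hθ
  have h1 : 1 - 2 * θ = a / (a + b) := by rw [hθ]; field_simp; ring
  have hθ2 : θ < 1 / 2 := by
    have : 0 < a / (a + b) := by positivity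
    linarith
  have hmgf := mgf_sq_norm_stdGaussian (E := E) hθ2
  have hpos : 0 < (√(1 - 2 * θ))⁻¹ ^ finrank ℝ E := by
    rw [h1]; positivity
  -- A nonintegrable function has integral 0 by convention, contradicting the positive value of the
  -- moment generating function.
  have hint : Integrable (fun x : E => Real.exp (θ * ‖x‖ ^ 2)) (stdGaussian E) := by
    by_contra hcon
    rw [mgf, integral_undef hcon] at hmgf
    linarith
  have hset : {x : E | a + b ≤ ‖x‖} = {x : E | (a + b) ^ 2 ≤ ‖x‖ ^ 2} := by
    ext x
    simp only [Set.mem_ofPred_eq]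
    rw [sq_le_sq₀ (by positivity) (by positivity)]
  rw [hset]
  refine (measure_ge_le_exp_mul_mgf (X := fun x : E => ‖x‖ ^ 2) ((a + b) ^ 2)
    (show 0 ≤ θ by positivity) hint).trans ?_
  rw [hmgf]
  have h2 : (√(1 - 2 * θ))⁻¹ ≤ Real.exp (b / (2 * a)) := by
    rw [h1, ← Real.sqrt_inv, Real.sqrt_le_left (by positivity), ← Real.exp_nat_mul, inv_div]
    have := Real.add_one_le_exp (b / a)
    calc (a + b) / a = b / a + 1 := by field_simp; ring
      _ ≤ _ := this
      _ = _ := by congr 1; push_cast; field_simp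
  calc Real.exp (-θ * (a + b) ^ 2) * (√(1 - 2 * θ))⁻¹ ^ finrank ℝ E
      ≤ Real.exp (-θ * (a + b) ^ 2) * Real.exp (b / (2 * a)) ^ finrank ℝ E := by gcongr
    _ ≤ Real.exp (-θ * (a + b) ^ 2) * Real.exp (b / (2 * a)) ^ d := by
        gcongr
        exact Real.one_le_exp (by positivity)
    _ = Real.exp (-v) := by
        rw [← Real.exp_nat_mul, ← Real.exp_add, ← hd', hθ]
        congr 1
        field_simp
        nlinarith

lemma measureReal_norm_starProjection_le (V : Submodule ℝ E) {d : ℕ} (hd : 0 < d)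
    (hV : finrank ℝ V ≤ d) {v : ℝ} (hv : 0 < v) :
    (stdGaussian E).real {x | √d + √(2 * v) ≤ ‖V.starProjection x‖} ≤ Real.exp (-v) := by
  have h := measureReal_norm_stdGaussian_le hd hV hv
  rw [← stdGaussian_map_orthogonalProjectionOnto V, map_measureReal_apply (by fun_prop)
    (measurableSet_le (by fun_prop) (by fun_prop))] at h
  exact h

lemma measureReal_inner_ge_le (ψ : E) (hψ : ψ ≠ 0) {r : ℝ} (hr : 0 ≤ r) :
    (stdGaussian E).real {x | ‖ψ‖ * r ≤ ⟪ψ, x⟫} ≤ Real.exp (-(r ^ 2 / 2)) := by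
  have hψ' : 0 < ‖ψ‖ := norm_pos_iff.2 hψ
  have hmap : (stdGaussian E).map (fun x => ⟪ψ, x⟫) = gaussianReal 0 (‖ψ‖₊ ^ 2) := by
    have h := IsGaussian.map_eq_gaussianReal (μ := stdGaussian E) (innerSL ℝ ψ)
    rw [integral_strongDual_stdGaussian, variance_dual_stdGaussian, innerSL_apply_norm] at h
    rw [Real.toNNReal_pow (norm_nonneg _), norm_toNNReal] at h
    exact h
  have hm := mgf_gaussianReal hmap (r / ‖ψ‖)
  have hint : Integrable (fun x => Real.exp (r / ‖ψ‖ * ⟪ψ, x⟫)) (stdGaussian E) := by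
    by_contra hcon
    rw [mgf, integral_undef hcon] at hm
    exact (Real.exp_pos _).ne hm
  refine (measure_ge_le_exp_mul_mgf (X := fun x => ⟪ψ, x⟫) (‖ψ‖ * r)
    (show 0 ≤ r / ‖ψ‖ by positivity) hint).trans (le_of_eq ?_)
  rw [hm, ← Real.exp_add]
  congr 1
  push_cast
  field_simp
  ring

lemma measureReal_abs_inner_gt_le (ψ : E) {r : ℝ} (hr : 0 ≤ r) :
    (stdGaussian E).real {x | ‖ψ‖ * r < |⟪ψ, x⟫|} ≤ 2 * Real.exp (-(r ^ 2 / 2)) := by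
  rcases eq_or_ne ψ 0 with rfl | hψ
  · simp
    positivity
  have h1 := measureReal_inner_ge_le ψ hψ hr
  have h2 := measureReal_inner_ge_le (-ψ) (neg_ne_zero.2 hψ) hr
  rw [norm_neg] at h2
  calc (stdGaussian E).real {x | ‖ψ‖ * r < |⟪ψ, x⟫|}
      ≤ (stdGaussian E).real ({x | ‖ψ‖ * r ≤ ⟪ψ, x⟫} ∪ {x | ‖ψ‖ * r ≤ ⟪-ψ, x⟫}) := by
        refine measureReal_mono fun x hx => ?_
        rw [Set.mem_ofPred_eq, lt_abs] at hx
        rcases hx with hx | hx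
        · exact Or.inl hx.le
        · exact Or.inr (by rw [Set.mem_ofPred_eq, inner_neg_left]; exact hx.le)
    _ ≤ _ := (measureReal_union_le _ _).trans (by linarith)

end Gaussian

end TrendFilter

/-! ### The oracle inequality and the noise event. -/

namespace TrendFilter

open Module
open scoped RealInnerProductSpace

section Oracle

variable {E κ : Type*} [NormedAddCommGroup E] [InnerProductSpace ℝ E] [Fintype κ]

/-- The first order optimality condition of an `ℓ¹`-penalized least squares problem. -/
lemma inner_le_of_isMin (A : E →ₗ[ℝ] (κ → ℝ)) {N lam : ℝ} (hN : 0 < N) (hlam : 0 ≤ lam)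
    {y f g : E} (hmin : ∀ f', ‖y - g‖ ^ 2 / N + 2 * lam * ∑ j, |A g j| ≤
      ‖y - f'‖ ^ 2 / N + 2 * lam * ∑ j, |A f' j|) :
    ⟪y - g, f - g⟫ / N ≤ lam * (∑ j, |A f j| - ∑ j, |A g j|) := by
  set c := ‖f - g‖ ^ 2 / N with hc
  set p := ⟪y - g, f - g⟫ / N with hp
  set d := lam * (∑ j, |A f j| - ∑ j, |A g j|) with hd
  have hc0 : 0 ≤ c := by positivity
  -- Compare g with g + τ(f - g), use convexity of the penalty and divide by τ; small τ then gives p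
  -- ≤ d.
  have key : ∀ τ : ℝ, 0 < τ → τ < 1 → 2 * (p - d) ≤ τ * c := by
    intro τ h0 h1
    have h := hmin (g + τ • (f - g))
    have e1 : ‖y - (g + τ • (f - g))‖ ^ 2 / N = ‖y - g‖ ^ 2 / N - 2 * τ * p + τ ^ 2 * c := by
      rw [← sub_sub, norm_sub_sq_real, inner_smul_right, norm_smul, mul_pow, Real.norm_eq_abs,
        sq_abs, hp, hc]
      ring
    have e2 : ∑ j, |A (g + τ • (f - g)) j| ≤ (1 - τ) * ∑ j, |A g j| + τ * ∑ j, |A f j| := by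
      rw [Finset.mul_sum, Finset.mul_sum, ← Finset.sum_add_distrib]
      refine Finset.sum_le_sum fun j _ => ?_
      have : A (g + τ • (f - g)) j = (1 - τ) * A g j + τ * A f j := by
        simp only [map_add, map_smul, map_sub, Pi.add_apply, Pi.smul_apply, Pi.sub_apply,
          smul_eq_mul]
        ring
      rw [this]
      refine (abs_add_le _ _).trans ?_
      rw [abs_mul, abs_mul, abs_of_pos h0, abs_of_pos (sub_pos.2 h1)]
    have e3 : 2 * lam * ∑ j, |A (g + τ • (f - g)) j| ≤
        2 * lam * ((1 - τ) * ∑ j, |A g j| + τ * ∑ j, |A f j|) := by gcongr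
    have e4 : 2 * lam * ((1 - τ) * ∑ j, |A g j| + τ * ∑ j, |A f j|) =
        2 * lam * ∑ j, |A g j| + 2 * τ * d := by rw [hd]; ring
    have e5 : τ * (2 * (p - d)) ≤ τ * (τ * c) := by nlinarith
    exact le_of_mul_le_mul_left e5 h0
  by_contra hcon
  have he : 0 < p - d := by linarith
  have hden : 0 < p - d + c + 1 := by linarith
  have h := key ((p - d) / (p - d + c + 1)) (by positivity) (by rw [div_lt_one hden]; linarith)
  rw [div_mul_eq_mul_div, le_div_iff₀ hden] at h
  nlinarith

/-- The oracle inequality for a vector `Q` interpolating signs on the active set. -/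
lemma oracle_inequality (A : E →ₗ[ℝ] (κ → ℝ)) {N lam a Γ : ℝ} (hN : 0 < N) (hlam : 0 ≤ lam)
    {y f₀ f g : E} (hmin : ∀ f', ‖y - g‖ ^ 2 / N + 2 * lam * ∑ j, |A g j| ≤
      ‖y - f'‖ ^ 2 / N + 2 * lam * ∑ j, |A f' j|)
    (S : κ → Prop) [DecidablePred S] (Q : κ → ℝ)
    (hQS : ∀ j, S j → Q j * A f j = |A f j| ∧ |Q j| ≤ 1)
    (hε : ⟪y - f₀, g - f⟫ / N ≤ a * (‖g - f‖ / √N) +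
      lam * ∑ j, if S j then 0 else (1 - |Q j|) * |A (g - f) j|)
    (hΓ : |∑ j, Q j * A (g - f) j| ≤ Γ * (‖g - f‖ / √N)) :
    ‖g - f₀‖ ^ 2 / N ≤ ‖f - f₀‖ ^ 2 / N + 4 * lam * (∑ j, if S j then 0 else |A f j|) +
      (a + lam * Γ) ^ 2 := by
  have h1 := inner_le_of_isMin A hN hlam (f := f) hmin
  -- On S, Q is a subgradient of the absolute value at `A f j`. Off S, the triangle inequality and
  -- |QA| ≤ |Q||A| leave the slack term, which will cancel against the noise.
  have hpt : ∀ j, |A f j| - |A g j| ≤ 2 * (if S j then 0 else |A f j|) - Q j * A (g - f) j -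
      (if S j then 0 else (1 - |Q j|) * |A (g - f) j|) := by
    intro j
    have e : A (g - f) j = A g j - A f j := by simp
    split_ifs with hS
    · obtain ⟨h2, h3⟩ := hQS j hS
      have h4 : Q j * A g j ≤ |A g j| := by
        refine (le_abs_self _).trans ?_
        rw [abs_mul]
        exact mul_le_of_le_one_left (abs_nonneg _) h3
      rw [e, mul_sub, h2]
      linarith
    · have h2 : |A (g - f) j| ≤ |A g j| + |A f j| := by rw [e]; exact abs_sub _ _
      have h3 : Q j * A (g - f) j ≤ |Q j| * |A (g - f) j| := by
        rw [← abs_mul]; exact le_abs_self _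
      linarith
  have hsum := Finset.sum_le_sum fun j (_ : j ∈ Finset.univ) => hpt j
  rw [Finset.sum_sub_distrib, Finset.sum_sub_distrib, Finset.sum_sub_distrib, ← Finset.mul_sum]
    at hsum
  set W := ∑ j, if S j then 0 else (1 - |Q j|) * |A (g - f) j|
  set I := ∑ j, if S j then 0 else |A f j|
  set x := ‖g - f‖ / √N with hx
  have hx2 : ‖g - f‖ ^ 2 / N = x ^ 2 := by rw [hx, div_pow, Real.sq_sqrt hN.le]
  have hexp : ‖g - f₀‖ ^ 2 / N = ‖f - f₀‖ ^ 2 / N - ‖g - f‖ ^ 2 / N + 2 * (⟪y - f₀, g - f⟫ / N) +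
      2 * (⟪y - g, f - g⟫ / N) := by
    have e1 : ‖f - f₀‖ ^ 2 = ‖g - f₀‖ ^ 2 - 2 * ⟪g - f₀, g - f⟫ + ‖g - f‖ ^ 2 := by
      rw [← norm_sub_sq_real]
      congr 2
      abel
    have e2 : y - f₀ = (y - g) + (g - f₀) := by abel
    have e3 : ⟪y - g, f - g⟫ = -⟪y - g, g - f⟫ := by rw [← inner_neg_right, neg_sub]
    rw [e1, e2, inner_add_left, e3]
    ring
  have h2 : lam * (∑ j, |A f j| - ∑ j, |A g j|) ≤
      lam * (2 * I - ∑ j, Q j * A (g - f) j - W) := by gcongr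
  have h3 : lam * (-∑ j, Q j * A (g - f) j) ≤ lam * (Γ * x) := by
    gcongr
    exact (neg_le_abs _).trans hΓ
  rw [hexp, hx2]
  -- Completing the square: 2(a + λΓ)x - x² ≤ (a + λΓ)².
  nlinarith [sq_nonneg (x - (a + lam * Γ))]

end Oracle

section Noise

variable {E κ : Type*} [NormedAddCommGroup E] [InnerProductSpace ℝ E] [FiniteDimensional ℝ E]
  [Fintype κ]

/-- The noise is controlled on the subspace `V` and along the directions `ψ`. -/
def noiseEvent (V : Submodule ℝ E) (ψ : κ → E) (a r : ℝ) : Set E :=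
  {x | ‖V.starProjection x‖ ≤ a ∧ ∀ j, |⟪ψ j, x⟫| ≤ ‖ψ j‖ * r}

/-- The projection is self-adjoint, so the V-part of h meets only the V-part of the noise; the rest
is estimated coordinatewise. -/
lemma inner_le_of_mem_noiseEvent {V : Submodule ℝ E} {ψ : κ → E} {a r : ℝ} {x h : E}
    (hx : x ∈ noiseEvent V ψ a r) {b : κ → ℝ} (hh : h = V.starProjection h + ∑ j, b j • ψ j) :
    ⟪x, h⟫ ≤ a * ‖h‖ + ∑ j, ‖ψ j‖ * r * |b j| := by
  have e : ⟪x, h⟫ = ⟪V.starProjection x, h⟫ + ∑ j, b j * ⟪ψ j, x⟫ := by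
    nth_rewrite 1 [hh]
    rw [inner_add_right, ← Submodule.inner_starProjection_left_eq_right, inner_sum]
    simp only [inner_smul_right, real_inner_comm x]
  rw [e]
  refine add_le_add ((real_inner_le_norm _ _).trans ?_) (Finset.sum_le_sum fun j _ => ?_)
  · gcongr
    exact hx.1
  · refine (le_abs_self _).trans ?_
    rw [abs_mul, mul_comm]
    gcongr
    exact hx.2 j

variable [MeasurableSpace E] [BorelSpace E]

lemma measurableSet_noiseEvent (V : Submodule ℝ E) (ψ : κ → E) (a r : ℝ) :
    MeasurableSet (noiseEvent V ψ a r) := by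
  have : noiseEvent V ψ a r =
      {x | ‖V.starProjection x‖ ≤ a} ∩ ⋂ j, {x : E | |⟪ψ j, x⟫| ≤ ‖ψ j‖ * r} := by
    ext x; simp [noiseEvent]
  rw [this]
  exact (measurableSet_le (by fun_prop) (by fun_prop)).inter
    (MeasurableSet.iInter fun j => measurableSet_le (by fun_prop) (by fun_prop))

lemma le_measureReal_noiseEvent (V : Submodule ℝ E) (ψ : κ → E) {d m : ℕ} (hd : 0 < d)
    (hV : finrank ℝ V ≤ d) (hm : Fintype.card κ ≤ m) {u v : ℝ} (hu : 0 < u) (hv : 0 < v) :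
    1 - Real.exp (-u) - Real.exp (-v) ≤ (stdGaussian E).real
      (noiseEvent V ψ (√d + √(2 * v)) √(2 * Real.log (2 * m) + 2 * u)) := by
  set r := √(2 * Real.log (2 * m) + 2 * u)
  have hlog : 0 ≤ Real.log (2 * m) := by
    have := Real.log_natCast_nonneg (2 * m)
    push_cast at this
    exact this
  have hcompl := probReal_compl_eq_one_sub (μ := stdGaussian E)
    (measurableSet_noiseEvent V ψ (√d + √(2 * v)) r)
  have hsub : (noiseEvent V ψ (√d + √(2 * v)) r)ᶜ ⊆
      {x | √d + √(2 * v) ≤ ‖V.starProjection x‖} ∪ ⋃ j, {x | ‖ψ j‖ * r < |⟪ψ j, x⟫|} := by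
    intro x hx
    rw [Set.mem_compl_iff, noiseEvent, Set.mem_ofPred_eq, not_and_or, not_le, not_forall] at hx
    rcases hx with hx | ⟨j, hj⟩
    · exact Or.inl hx.le
    · exact Or.inr (Set.mem_iUnion.2 ⟨j, not_le.1 hj⟩)
  have h1 := measureReal_norm_starProjection_le V hd hV hv
  have h2 : (stdGaussian E).real (⋃ j, {x | ‖ψ j‖ * r < |⟪ψ j, x⟫|}) ≤ Real.exp (-u) := by
    refine (measureReal_iUnion_fintype_le _).trans ?_
    refine (Finset.sum_le_card_nsmul _ _ _ fun j _ =>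
      measureReal_abs_inner_gt_le (ψ j) (Real.sqrt_nonneg _)).trans ?_
    rw [Finset.card_univ, nsmul_eq_mul, Real.sq_sqrt (by positivity)]
    -- Without directions m may be 0, and `Real.log 0 = 0`; the union is then empty. Otherwise each
    -- direction costs exp(-u)/m.
    rcases Nat.eq_zero_or_pos (Fintype.card κ) with h0 | h0
    · rw [h0]; simp; positivity
    have hm0 : (0 : ℝ) < m := by exact_mod_cast h0.trans_le hm
    have hcm : (Fintype.card κ : ℝ) ≤ m := by exact_mod_cast hm
    have e : 2 * Real.exp (-((2 * Real.log (2 * m) + 2 * u) / 2)) = Real.exp (-u) / m := by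
      rw [show -((2 * Real.log (2 * m) + 2 * u) / 2) = -u - Real.log (2 * m) by ring,
        Real.exp_sub, Real.exp_log (by positivity)]
      field_simp
    rw [e, ← mul_div_assoc, div_le_iff₀ hm0, mul_comm]
    gcongr
  have h3 := (measureReal_mono (μ := stdGaussian E) hsub).trans (measureReal_union_le _ _)
  linarith

end Noise

lemma map_pi_gaussianReal {ι : Type*} [Fintype ι] (f₀ : ι → ℝ) :
    (Measure.pi fun i => gaussianReal (f₀ i) 1).map (fun y => WithLp.toLp 2 (y - f₀)) =
      stdGaussian (EuclideanSpace ℝ ι) := by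
  rw [← map_pi_eq_stdGaussian]
  have h : (Measure.pi fun i => gaussianReal (f₀ i) 1).map (fun y i => y i - f₀ i) =
      Measure.pi fun _ => gaussianReal 0 1 := by
    rw [Measure.pi_map_pi (f := fun i x => x - f₀ i) fun i => by fun_prop]
    congr
    ext1 i
    rw [gaussianReal_map_sub_const, sub_self]
  rw [← h, Measure.map_map (by fun_prop) (by fun_prop)]
  rfl

end TrendFilter

/-! ### Assembly. -/

namespace TrendFilter

open Finset fwdDiff Module
open scoped RealInnerProductSpace

/-- `Δ(k)` on the Euclidean space. -/
noncomputable def diffMap (k n : ℕ) :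
    EuclideanSpace ℝ (Icc 1 n) →ₗ[ℝ] (Icc (k + 1) n → ℝ) :=
  (diffMatrix k n).mulVecLin ∘ₗ (WithLp.linearEquiv 2 ℝ (Vec n)).toLinearMap

lemma diffMap_toLp (k : ℕ) {n : ℕ} (f : Vec n) : diffMap k n (WithLp.toLp 2 f) = diff k f := rfl

lemma normSq_eq {n : ℕ} (f : Vec n) : normSq f = ‖WithLp.toLp 2 f‖ ^ 2 / n := by
  rw [normSq, EuclideanSpace.real_norm_sq_eq]

/-- The interior rows of `Δ(k)` on the Euclidean space. -/
noncomputable def interiorMap (k n s : ℕ) (t : ℕ → ℕ) :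
    EuclideanSpace ℝ (Icc 1 n) →ₗ[ℝ] (interior k n s t → ℝ) :=
  LinearMap.funLeft ℝ ℝ Subtype.val ∘ₗ diffMap k n

lemma interiorMap_apply {k n s : ℕ} {t : ℕ → ℕ} (h : EuclideanSpace ℝ (Icc 1 n))
    (j : interior k n s t) : interiorMap k n s t h j = diffMap k n h j := rfl

lemma interiorMap_toLp_eq_single {k n s : ℕ} {t : ℕ → ℕ} {χ : Vec n} {j : interior k n s t}
    (hχ : ∀ j' ∈ interior k n s t, diff k χ j' = if j' = j then 1 else 0) :
    interiorMap k n s t (WithLp.toLp 2 χ) = Pi.single j 1 := by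
  ext j'
  rw [interiorMap_apply, diffMap_toLp, hχ j' j'.2, Pi.single_apply]
  simp only [Subtype.ext_iff]

/-- Dual vectors make the interior rows independent, which fixes the kernel dimension; the shorter
of the left and right bounds on ‖ψ_j‖ yields the distance to the nearest knot. -/
lemma exists_interior_decomposition {k n s : ℕ} {t : ℕ → ℕ} (hk : 0 < k) (ht : IsKnots k n s t) :
    finrank ℝ (LinearMap.ker (interiorMap k n s t)) ≤ k * (s + 1) ∧
    ∃ ψ : interior k n s t → EuclideanSpace ℝ (Icc 1 n),
      (∀ h, h = (LinearMap.ker (interiorMap k n s t)).starProjection h +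
        ∑ j, interiorMap k n s t h j • ψ j) ∧
      ∀ (j : interior k n s t) (i : ℕ), i ≤ s → t i < (j : Icc (k + 1) n) →
        ((j : Icc (k + 1) n) : ℕ) < t (i + 1) →
        ‖ψ j‖ ^ 2 ≤ ((min (((j : Icc (k + 1) n) : ℕ) - t i)
          (t (i + 1) - ((j : Icc (k + 1) n) : ℕ)) : ℤ) : ℝ) ^ (2 * k - 1) := by
  have hdual : ∀ j, ∃ χ, interiorMap k n s t χ = Pi.single j 1 := by
    intro j
    obtain ⟨i, hi, h1, h2⟩ := exists_segment ht j (notMem_activeSet_of_mem_interior hk j.2)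
    obtain ⟨χ, hχ, -⟩ := exists_dual_right hk ht j hi h2
    exact ⟨_, interiorMap_toLp_eq_single hχ⟩
  constructor
  · have h1 := finrank_ker_add_card _ hdual
    rw [finrank_euclideanSpace, Fintype.card_coe, Fintype.card_coe, Nat.card_Icc] at h1
    have h2 := card_interior_ge k n s t
    omega
  · obtain ⟨ψ, hψ, hmin⟩ := exists_dual_decomposition _ hdual
    refine ⟨ψ, hψ, fun j i hi h1 h2 => ?_⟩
    have hbound : ∀ {χ : Vec n} {K : ℝ},
        (∀ j' ∈ interior k n s t, diff k χ j' = if j' = j then 1 else 0) →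
        ∑ x, χ x ^ 2 ≤ K → ‖ψ j‖ ^ 2 ≤ K := by
      intro χ K hχ hK
      refine le_trans ?_ hK
      rw [← EuclideanSpace.real_norm_sq_eq (WithLp.toLp 2 χ)]
      gcongr
      exact hmin _ _ (interiorMap_toLp_eq_single hχ)
    have hleft : 1 ≤ i → t i + k ≤ (j : Icc (k + 1) n) := by
      intro h
      have := j.2
      simp only [interior, mem_filter, mem_univ, true_and, mem_Icc] at this
      have := this i (by omega)
      omega
    obtain ⟨χ₁, hχ₁, hK₁⟩ := exists_dual_right hk ht j hi h2
    obtain ⟨χ₂, hχ₂, hK₂⟩ := exists_dual_left hk ht j hi h1 hleft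
    have b1 := hbound hχ₁ hK₁
    have b2 := hbound hχ₂ hK₂
    rcases min_choice ((((j : Icc (k + 1) n) : ℕ) : ℤ) - t i)
      (t (i + 1) - ((j : Icc (k + 1) n) : ℕ)) with h | h <;> rw [h]
    · exact b2
    · exact b1

lemma rpow_eq_sqrt {k : ℕ} (hk : 0 < k) {x : ℝ} (hx : 0 ≤ x) :
    x ^ ((2 * (k : ℝ) - 1) / 2) = √(x ^ (2 * k - 1)) := by
  rw [Real.sqrt_eq_rpow, ← Real.rpow_natCast, ← Real.rpow_mul hx]
  congr 1
  push_cast [show 1 ≤ 2 * k by omega]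
  ring

/-- The lower bound on the tuning parameter makes the noise along an interior direction negligible
compared with the slack of the interpolating vector. -/
lemma mul_div_le_of_tuning {k : ℕ} (hk : 0 < k) {n M δ r lam z : ℝ} (hn : 0 < n) (hM : 0 < M)
    (hδ : 0 < δ) (hr : 0 ≤ r) (hz : 0 ≤ z)
    (hlam : 2 ^ k / δ * n ^ (k - 1) * √((M / (2 * n)) ^ (2 * k - 1)) * (r / √n) ≤ lam) :
    √(z ^ (2 * k - 1)) * r / n ≤ lam * (δ * √((z / M) ^ (2 * k - 1))) := by
  have e1 : √((M / (2 * n)) ^ (2 * k - 1)) * √((z / M) ^ (2 * k - 1)) =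
      √(z ^ (2 * k - 1)) / √((2 * n) ^ (2 * k - 1)) := by
    rw [← Real.sqrt_mul (by positivity), ← mul_pow, ← Real.sqrt_div (by positivity), ← div_pow]
    congr 2
    field_simp
  -- The factor 2^k in the tuning constant absorbs the 2n of the normalisation (n_max / 2n)^(k-1/2).
  have e2 : √n * √((2 * n) ^ (2 * k - 1)) ≤ 2 ^ k * n ^ (k - 1) * n := by
    rw [← Real.sqrt_mul hn.le, Real.sqrt_le_left (by positivity)]
    have : (2 : ℝ) ^ (2 * k - 1) ≤ 2 ^ (2 * k) := pow_le_pow_right₀ (by norm_num) (by omega)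
    calc n * (2 * n) ^ (2 * k - 1) = 2 ^ (2 * k - 1) * n ^ (2 * k - 1 + 1) := by
          rw [mul_pow]; ring
      _ ≤ 2 ^ (2 * k) * n ^ (2 * k - 1 + 1) := by gcongr
      _ = (2 ^ k * n ^ (k - 1) * n) ^ 2 := by
          rw [mul_assoc, ← pow_succ, mul_pow, ← pow_mul, ← pow_mul, mul_comm k 2]
          congr 2
          omega
  have hs : 0 < √n := Real.sqrt_pos.2 hn
  have hs2 : 0 < √((2 * n) ^ (2 * k - 1)) := by positivity
  calc √(z ^ (2 * k - 1)) * r / n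
      ≤ √(z ^ (2 * k - 1)) * r * (2 ^ k * n ^ (k - 1) / (√n * √((2 * n) ^ (2 * k - 1)))) := by
        rw [div_eq_mul_inv]
        gcongr
        rw [inv_eq_one_div, div_le_div_iff₀ hn (by positivity), one_mul]
        exact e2
    _ = 2 ^ k / δ * n ^ (k - 1) * (√(z ^ (2 * k - 1)) / √((2 * n) ^ (2 * k - 1))) * (r / √n)
          * δ := by field_simp
    _ = 2 ^ k / δ * n ^ (k - 1) * √((M / (2 * n)) ^ (2 * k - 1)) * (r / √n) *
          (δ * √((z / M) ^ (2 * k - 1))) := by rw [← e1]; ring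
    _ ≤ _ := by gcongr

end TrendFilter

open TrendFilter in
theorem theorem1p1 (k : ℕ) (hk : k ∈ ({1, 2, 3, 4} : Finset ℕ)) :
    ∃ c C : ℝ, 0 < c ∧ 0 < C ∧
      ∀ (n s : ℕ) (t : ℕ → ℕ), TrendFilter.IsKnots k n s t →
      ∀ (Ω : Type*) [MeasurableSpace Ω] (P : Measure Ω) [IsProbabilityMeasure P]
        (f₀ : TrendFilter.Vec n) (Y fhat : Ω → TrendFilter.Vec n) (lam u : ℝ),
        HasLaw Y (Measure.pi fun i => gaussianReal (f₀ i) 1) P →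
        (∀ ω, TrendFilter.IsEstimator k lam (Y ω) (fhat ω)) →
        0 < u →
        c * (n : ℝ) ^ (k - 1)
            * ((TrendFilter.maxSegLen s t : ℝ) / (2 * n)) ^ ((2 * (k : ℝ) - 1) / 2)
            * TrendFilter.lambda₀ n k s u ≤ lam →
        ∀ (f : TrendFilter.Vec n) (q : ℕ → ℝ), TrendFilter.IsSignVector k s t f q →
        (∀ i ∈ TrendFilter.signChanges s q, k * (k + 2) ≤ TrendFilter.segLen t i) →
        ∀ v : ℝ, 0 < v →
          1 - Real.exp (-u) - Real.exp (-v) ≤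
            P.real {ω | TrendFilter.normSq (fhat ω - f₀) ≤
              TrendFilter.normSq (f - f₀) + 4 * lam * TrendFilter.inactiveL1 k s t f
                + (√((k : ℝ) * (s + 1) / n) + √(2 * v / n)
                    + lam * √(TrendFilter.gammaSq n k s t q C)) ^ 2} := by
  have hk0 : 0 < k := by
    rcases Nat.eq_zero_or_pos k with rfl | h
    · simp at hk
    · exact h
  obtain ⟨C, δ, hC, hδ, hQ⟩ := exists_interpolant k hk0
  refine ⟨2 ^ k / δ, C, by positivity, hC, ?_⟩
  intro n s t ht Ω _ P _ f₀ Y fhat lam u hY hfhat hu hlam f q hq hlen v hv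
  obtain ⟨Q, hQ0, hQn, hQt, hQseg, hQΔ⟩ := hQ n s t ht q (fun i hi => (hq i hi).1)
    (fun i hi => le_trans (by nlinarith) (hlen i hi))
  obtain ⟨hrank, ψ, hψ, hψn⟩ := exists_interior_decomposition hk0 ht
  set V := LinearMap.ker (interiorMap k n s t)
  have hcard := card_interior_add_le hk0 ht
  have hksn : k + s ≤ n := by
    have h1 : ∀ i ≤ s + 1, k + i ≤ t i := by
      intro i
      induction i with
      | zero => intro _; rw [ht.left]; omega
      | succ i ih =>
        intro hi
        have := ih (by omega)
        have := ht.strictMono i (by omega)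
        omega
    have := h1 (s + 1) le_rfl
    rw [ht.right] at this
    omega
  have hn0 : (0 : ℝ) < n := by exact_mod_cast (by omega : 0 < n)
  set m := n - k - s with hm
  have hmcast : (n : ℝ) - k - s = (m : ℕ) := by
    rw [hm, Nat.sub_sub, Nat.cast_sub hksn]
    push_cast
    ring
  set r := √(2 * Real.log (2 * m) + 2 * u) with hr
  have hr0 : 0 ≤ r := Real.sqrt_nonneg _
  have hM0 : (0 : ℝ) < maxSegLen s t := by
    exact_mod_cast (ht.segLen_pos (Nat.zero_le s)).trans_le
      (IsKnots.segLen_le_max (Nat.zero_le s))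
  rw [rpow_eq_sqrt hk0 (by positivity), lambda₀, hmcast, Real.sqrt_div' _ hn0.le, ← hr] at hlam
  have hlam0 : 0 ≤ lam := le_trans (by positivity) hlam
  -- The decisive comparison: noise along ψ_j and slack of Q scale alike in the distance to the
  -- knots.
  have hslack : ∀ j : interior k n s t, ‖ψ j‖ * r / n ≤
      lam * (1 - |Q ((j : Finset.Icc (k + 1) n) : ℕ)|) := by
    intro j
    obtain ⟨i, hi, h1, h2⟩ := exists_segment ht j (notMem_activeSet_of_mem_interior hk0 j.2)
    have hb := hψn j i hi h1 h2
    have hs := hQseg i hi ((j : Finset.Icc (k + 1) n) : ℕ) (by omega) (by omega)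
    set z : ℝ := ((min ((((j : Finset.Icc (k + 1) n) : ℕ) : ℤ) - t i)
      (t (i + 1) - ((j : Finset.Icc (k + 1) n) : ℕ)) : ℤ) : ℝ) with hz
    have hz0 : 0 ≤ z := Int.cast_nonneg (by omega)
    have h3 := mul_div_le_of_tuning hk0 hn0 hM0 hδ hr0 hz0 hlam
    have h4 : ‖ψ j‖ ≤ √(z ^ (2 * k - 1)) := Real.le_sqrt_of_sq_le hb
    calc ‖ψ j‖ * r / n ≤ √(z ^ (2 * k - 1)) * r / n := by gcongr
      _ ≤ _ := h3
      _ ≤ _ := by gcongr; linarith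
  have hQle : ∀ j : Finset.Icc (k + 1) n, (j : ℕ) ∉ activeSet s t → |Q (j : ℕ)| ≤ 1 := by
    intro j hj
    obtain ⟨i, hi, h1, h2⟩ := exists_segment ht j hj
    have hs := hQseg i hi (j : ℕ) (by omega) (by omega)
    refine hs.trans ?_
    rw [sub_le_self_iff]
    positivity
  set G := noiseEvent V ψ (√((k * (s + 1) : ℕ) : ℝ) + √(2 * v)) r with hG
  have hGprob := le_measureReal_noiseEvent V ψ (d := k * (s + 1)) (m := m) (by positivity) hrank
    (by rw [Fintype.card_coe]; omega) hu hv
  have hmeas : Measurable fun y : Vec n => WithLp.toLp 2 (y - f₀) := by fun_prop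
  rw [← map_pi_gaussianReal f₀, map_measureReal_apply hmeas (measurableSet_noiseEvent _ _ _ _),
    ← hY.map_eq, map_measureReal_apply_of_aemeasurable hY.aemeasurable
      (hmeas (measurableSet_noiseEvent _ _ _ _))] at hGprob
  -- From here on the argument is deterministic: the noise event implies the oracle bound for every
  -- minimizer.
  refine hGprob.trans (measureReal_mono fun ω hω => ?_)
  simp only [Set.mem_ofPred_eq]
  have hω' : WithLp.toLp 2 (Y ω - f₀) ∈ G := hω
  have horacle := oracle_inequality (diffMap k n) (N := n) (lam := lam)
    (a := √((k : ℝ) * (s + 1) / n) + √(2 * v / n)) (Γ := √(gammaSq n k s t q C)) hn0 hlam0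
    (y := WithLp.toLp 2 (Y ω)) (f₀ := WithLp.toLp 2 f₀) (f := WithLp.toLp 2 f)
    (g := WithLp.toLp 2 (fhat ω)) ?_ (fun j => (j : ℕ) ∈ activeSet s t) (fun j => Q (j : ℕ))
    ?_ ?_ ?_
  · rw [normSq_eq, normSq_eq]
    exact horacle
  · intro f'
    have := hfhat ω (WithLp.ofLp f')
    simp only [objective, normSq_eq] at this
    exact this
  · intro j hj
    obtain ⟨i, hi, hij⟩ := Finset.mem_image.1 hj
    obtain ⟨hq1, hq2⟩ := hq i hi
    have hqi : Q (j : ℕ) = q i := by rw [← hij]; exact hQt i hi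
    have hqs := hq2 j hij.symm
    rw [diffMap_toLp, hqi]
    constructor
    · rcases eq_or_ne (diff k f j) 0 with h | h
      · simp [h]
      · rw [hqs h]
        rcases lt_or_gt_of_ne h with h | h
        · rw [Real.sign_of_neg h, abs_of_neg h, neg_one_mul]
        · rw [Real.sign_of_pos h, abs_of_pos h, one_mul]
    · rcases hq1 with h | h <;> simp [h]
  · have h1 := inner_le_of_mem_noiseEvent hω' (hψ (WithLp.toLp 2 (fhat ω) - WithLp.toLp 2 f))
    set h := WithLp.toLp 2 (fhat ω) - WithLp.toLp 2 f
    have h2 : (∑ j, ‖ψ j‖ * r * |interiorMap k n s t h j|) / n ≤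
        lam * ∑ j : Finset.Icc (k + 1) n, if (j : ℕ) ∈ activeSet s t then 0 else
          (1 - |Q (j : ℕ)|) * |diffMap k n h j| := by
      rw [Finset.sum_div, Finset.mul_sum]
      calc ∑ j, ‖ψ j‖ * r * |interiorMap k n s t h j| / n
          ≤ ∑ j : interior k n s t, lam * (if ((j : Finset.Icc (k + 1) n) : ℕ) ∈ activeSet s t
            then 0 else (1 - |Q ((j : Finset.Icc (k + 1) n) : ℕ)|) * |diffMap k n h j|) := by
            refine Finset.sum_le_sum fun j _ => ?_
            rw [if_neg (notMem_activeSet_of_mem_interior hk0 j.2), interiorMap_apply,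
              mul_div_right_comm, ← mul_assoc]
            gcongr
            exact hslack j
        _ = ∑ j ∈ interior k n s t, lam * (if (j : ℕ) ∈ activeSet s t
            then 0 else (1 - |Q (j : ℕ)|) * |diffMap k n h j|) :=
            Finset.sum_coe_sort (interior k n s t) (fun j => lam * (if (j : ℕ) ∈ activeSet s t
              then 0 else (1 - |Q (j : ℕ)|) * |diffMap k n h j|))
        _ ≤ _ := by
            refine Finset.sum_le_sum_of_subset_of_nonneg (Finset.subset_univ _) fun j _ _ => ?_
            split_ifs with hj
            · simp
            · have := sub_nonneg.2 (hQle j hj)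
              positivity
    have h3 : (√((k * (s + 1) : ℕ) : ℝ) + √(2 * v)) * ‖h‖ / n =
        (√((k : ℝ) * (s + 1) / n) + √(2 * v / n)) * (‖h‖ / √n) := by
      rw [Real.sqrt_div' _ hn0.le, Real.sqrt_div' _ hn0.le, ← add_div, div_mul_div_comm,
        Real.mul_self_sqrt hn0.le]
      push_cast
      rfl
    calc _ ≤ ((√((k * (s + 1) : ℕ) : ℝ) + √(2 * v)) * ‖h‖ +
          ∑ j, ‖ψ j‖ * r * |interiorMap k n s t h j|) / n := by
          gcongr
          exact h1
      _ ≤ _ := by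
          rw [add_div, h3]
          gcongr
  · set h := fhat ω - f with hh
    -- The differences pass from h to Q; Cauchy–Schwarz and the square-sum bound for Δᵏ Q then give
    -- Γ_S.
    rw [← WithLp.toLp_sub, diffMap_toLp, sum_mul_diff k hQ0 hQn]
    set B := C * (∑ i ∈ signChanges s q,
        (1 + Real.log (segLen t i)) / (segLen t i : ℝ) ^ (2 * k - 1)
        + ∑ i ∈ Finset.Icc 1 (s + 1) \ signChanges s q,
        (1 + Real.log (segLen t i)) / (maxSegLen s t : ℝ) ^ (2 * k - 1)) with hB
    have hB0 : 0 ≤ B := hQΔ.nonneg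
    have hsum : ∑ x : Finset.Icc 1 n, ((-1) ^ k * (fwdDiff 1)^[k] Q ((x : ℕ) : ℤ)) ^ 2 ≤ B := by
      have := hQΔ ((Finset.Icc 1 n).map Nat.castEmbedding)
      rw [Finset.sum_map] at this
      rw [Finset.sum_coe_sort (Finset.Icc 1 n)
        (fun x : ℕ => ((-1) ^ k * (fwdDiff 1)^[k] Q (x : ℤ)) ^ 2)]
      refine le_trans (le_of_eq (Finset.sum_congr rfl fun x _ => ?_)) this
      rw [mul_pow, ← pow_mul, mul_comm k 2, pow_mul, neg_one_sq, one_pow, one_mul]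
      rfl
    have hΓ : √(gammaSq n k s t q C) * (‖WithLp.toLp 2 h‖ / √n) = √B * ‖WithLp.toLp 2 h‖ := by
      rw [gammaSq, mul_assoc, ← hB, Real.sqrt_mul hn0.le]
      have := Real.sqrt_pos.2 hn0
      field_simp
    rw [hΓ, EuclideanSpace.norm_eq]
    simp only [Real.norm_eq_abs, sq_abs]
    rw [← Real.sqrt_mul hB0]
    refine Real.abs_le_sqrt ?_
    refine (Finset.sum_mul_sq_le_sq_mul_sq _ _ _).trans ?_
    gcongr
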